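/- Let $V^2$ be a connected smooth immersed surface in the three-dimensional conformal space $C^3$, the space of null lines of $\mathbb{R}^{5}$ with its scalar product $(\cdot,\cdot)$ of signature $(4,1)$ (equivalently, the sphere $S^3$ with its conformal structure); vectors $S$ with $(S,S)>0$, up to scale, represent spheres. A first-order conformal frame along $V^2$ (locally) is a smooth family of bases $A_0,A_1,A_2,A_3,A_4$ of $\mathbb{R}^5$ such that $A_0$ represents the current point of $V^2$, $(A_0,A_0)=(A_4,A_4)=0$, $(A_0,A_4)=-1$, $(A_3,A_3)=1$, $(A_i,A_j)=g_{ij}$ ($i,j=1,2$) is positive definite, all the other products vanish, and $(dA_0,A_3)=0$. Write $dA_\xi=\omega_\xi^\eta A_\eta$ and $\omega^i=\omega_0^i$, define $\lambda_{ij}$ and $\lambda_{ijk}$ by $$\omega_i^3=\lambda_{ij}\omega^j,\qquad d\lambda_{ij}-\lambda_{kj}\omega_i^k-\lambda_{ik}\omega_j^k+\lambda_{ij}\omega_0^0+g_{ij}\omega_3^0=\lambda_{ijk}\omega^k,$$ and set $a_{ij}=\lambda_{ij}-\tfrac12 g^{kl}\lambda_{kl}\,g_{ij}$. Assume that $a_{ij}$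 is nondegenerate at every point (that is, $V^2$ has no umbilics), and set $$a_{ijk}=\lambda_{ijk}+3\bigl(a_{(ij}g_{k)l}-g_{(ij}a_{k)l}\bigr)\mu^l,\qquad \mu^i=a^{ij}\lambda_j,\quad \lambda_k=\tfrac12 g^{ij}\lambda_{ijk},$$ where $g^{ij}$, $a^{ij}$ are the inverse matrices and the parentheses around indices denote symmetrization over $i,j,k$. The principal directions are the eigendirections of $g^{ik}a_{kj}$. Call $V^2$ a Dupin cyclide (or an open part of one) if near each of its points it is the envelope of two smooth regular one-parameter families of spheres whose characteristics are transversal to each other. Then $V^2$ is a Dupin cyclide if and only if $a_{ijk}$ vanishes identically (in every first-order frame). Moreover, $V^2$ is a Dupin cyclide if and only if it is 1-canal with respect to both principal directions, i.e. near each point and for each principal direction at that point, $V^2$ is the envelope of a smooth regular one-parameter family of spheres whose characteristic through the point has that direction. The same two equivalences hold for a connected smooth immersed surface in Euclidean space $\mathbb{R}^3$, where the families consist of Euclidean spheres or planes, and where nondegeneracy of $a_{ij}$, the principal directions and $a_{ijk}$ are those of the image of the surface under the conformal embedding $\mathbb{R}^3\subset C^3$ (inverse stereographic projection). -/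

import Mathlib

open scoped Manifold ContDiff Matrix RealInnerProductSpace

noncomputable section

namespace ConformalSurface

/-- Coordinate plane. -/
abbrev E2 := EuclideanSpace ℝ (Fin 2)

/-- Euclidean three-space. -/
abbrev E3 := EuclideanSpace ℝ (Fin 3)

/-- The conformal space `C^3`, modelled on the unit sphere of `ℝ⁴`
(the oval quadric of null lines of `ℝ^{4,1}`). -/
abbrev C3 := Metric.sphere (0 : EuclideanSpace ℝ (Fin 4)) 1

/-- Polyspherical coordinate vectors. -/
abbrev Poly := Fin 5 → ℝ

/-- The fundamental bilinear form of the conformal space, of signature `(4, 1)`.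
Null lines are points, vectors `X` with `0 < form X X` represent spheres, and
`form X S = 0` for a null `X` says that the sphere `S` passes through the point `X`. -/
def form (X Y : Poly) : ℝ := X 0 * Y 0 + X 1 * Y 1 + X 2 * Y 2 + X 3 * Y 3 - X 4 * Y 4

/-- The null vector representing a point of the conformal space. -/
def lift (p : C3) : Poly := ![p.1 0, p.1 1, p.1 2, p.1 3, 1]

/-- Positions of the tangential elements `A_1`, `A_2` in a conformal frame `A_0, …, A_4`. -/
def tg : Fin 2 → Fin 5 := ![1, 2]

section Frame

variable (A : Fin 5 → E2 → Poly)

/-- `g_{ij} = (A_i, A_j)`. -/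
def g (u : E2) : Matrix (Fin 2) (Fin 2) ℝ :=
  Matrix.of fun i j => form (A (tg i) u) (A (tg j) u)

/-- The matrix of 1-forms `ω_ξ^η` determined by `dA_ξ = ω_ξ^η A_η`, evaluated at `v`. -/
def omega (u v : E2) : Matrix (Fin 5) (Fin 5) ℝ :=
  (Matrix.of fun ξ => fderiv ℝ (A ξ) u v) * (Matrix.of fun ξ => A ξ u)⁻¹

/-- The values `ω^i(∂_k)` of the basis forms `ω^i = ω_0^i`. -/
def coframe (u : E2) : Matrix (Fin 2) (Fin 2) ℝ :=
  Matrix.of fun i k => omega A u (EuclideanSpace.single k 1) 0 (tg i)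

/-- The tangent basis dual to the basis forms: `ω^i (dual j) = δ^i_j`. -/
def dual (u : E2) (j : Fin 2) : E2 := ∑ k, (coframe A u)⁻¹ k j • EuclideanSpace.single k (1 : ℝ)

/-- `λ_{ij}`, determined by `ω_i^n = λ_{ij} ω^j`. -/
def lam (u : E2) : Matrix (Fin 2) (Fin 2) ℝ :=
  Matrix.of fun i j => omega A u (dual A u j) (tg i) 3

/-- `λ_{ijk}`, determined by
`dλ_{ij} - λ_{kj} ω_i^k - λ_{ik} ω_j^k + λ_{ij} ω_0^0 + g_{ij} ω_n^0 = λ_{ijk} ω^k`. -/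
def lam3 (u : E2) (i j k : Fin 2) : ℝ :=
  fderiv ℝ (fun w => lam A w i j) u (dual A u k)
    - ∑ l, lam A u l j * omega A u (dual A u k) (tg i) (tg l)
    - ∑ l, lam A u i l * omega A u (dual A u k) (tg j) (tg l)
    + lam A u i j * omega A u (dual A u k) 0 0
    + g A u i j * omega A u (dual A u k) 3 0

/-- `a_{ij} = λ_{ij} - λ g_{ij}` with `λ = (1/2) g^{ij} λ_{ij}`. -/
def a2 (u : E2) : Matrix (Fin 2) (Fin 2) ℝ :=
  lam A u - ((1 / 2 : ℝ) * ∑ i, ∑ j, (g A u)⁻¹ i j * lam A u i j) • g A u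

/-- `μ^i = a^{ij} λ_j` with `λ_k = (1/2) g^{ij} λ_{ijk}`. -/
def mu (u : E2) (l : Fin 2) : ℝ :=
  ∑ k, (a2 A u)⁻¹ l k * ((1 / 2 : ℝ) * ∑ i, ∑ j, (g A u)⁻¹ i j * lam3 A u i j k)

/-- `a_{ijk} = λ_{ijk} + 3 (a_{(ij} g_{k)l} - g_{(ij} a_{k)l}) μ^l`; three times the symmetrization
over `i, j, k` is the cyclic sum, as `a` and `g` are symmetric. -/
def a3 (u : E2) (i j k : Fin 2) : ℝ :=
  lam3 A u i j k
    + ∑ l, ((a2 A u i j * g A u k l + a2 A u j k * g A u i l + a2 A u k i * g A u j l)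
        - (g A u i j * a2 A u k l + g A u j k * a2 A u i l + g A u k i * a2 A u j l)) * mu A u l

/-- `v` is a principal vector at `u`: its components `ξ^i = ω^i(v)` satisfy
`a^i_j ξ^j = s ξ^i`, where `a^i_j = g^{ik} a_{kj}`. -/
def IsPrincipal (u v : E2) : Prop :=
  v ≠ 0 ∧ ∃ s : ℝ, ((g A u)⁻¹ * a2 A u) *ᵥ (fun i => omega A u v 0 (tg i))
    = s • fun i => omega A u v 0 (tg i)

end Frame

variable {M : Type*} [TopologicalSpace M] [ChartedSpace E2 M]

/-- A smooth field of first-order conformal frames `A_0, …, A_4` along the surface `f`, over the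
domain of a chart: `A_0` and `A_4` are points, `A_1, A_2, A_3` are spheres through them, `A_0` is
the point of the surface, `A_3` is tangent to the surface and `A_1`, `A_2` are orthogonal to it. -/
structure IsFirstOrderFrame (f : M → C3) (e : OpenPartialHomeomorph M E2)
    (A : Fin 5 → E2 → Poly) : Prop where
  smooth : ∀ ξ, ContDiffOn ℝ ∞ (A ξ) e.target
  point : ∀ u ∈ e.target, ∃ c : ℝ, c ≠ 0 ∧ A 0 u = c • lift (f (e.symm u))
  null_zero : ∀ u ∈ e.target, form (A 0 u) (A 0 u) = 0
  null_four : ∀ u ∈ e.target, form (A 4 u) (A 4 u) = 0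
  zero_four : ∀ u ∈ e.target, form (A 0 u) (A 4 u) = -1
  zero_three : ∀ u ∈ e.target, form (A 0 u) (A 3 u) = 0
  four_three : ∀ u ∈ e.target, form (A 4 u) (A 3 u) = 0
  three_three : ∀ u ∈ e.target, form (A 3 u) (A 3 u) = 1
  zero_tg : ∀ u ∈ e.target, ∀ i, form (A 0 u) (A (tg i) u) = 0
  four_tg : ∀ u ∈ e.target, ∀ i, form (A 4 u) (A (tg i) u) = 0
  tg_three : ∀ u ∈ e.target, ∀ i, form (A (tg i) u) (A 3 u) = 0
  metric : ∀ u ∈ e.target, (g A u).PosDef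
  tangent : ∀ u ∈ e.target, ∀ v, form (fderiv ℝ (A 0) u v) (A 3 u) = 0

/-- The tensor `a_{ij}` is nondegenerate at every point (in every first-order frame). -/
def IsNondegenerate (f : M → C3) : Prop :=
  ∀ e ∈ IsManifold.maximalAtlas (𝓡 2) ∞ M, ∀ A, IsFirstOrderFrame f e A →
    ∀ u ∈ e.target, (a2 A u).det ≠ 0

/-- The tensor `a_{ijk}` vanishes identically (in every first-order frame). -/
def ThirdTensorVanishes (f : M → C3) : Prop :=
  ∀ e ∈ IsManifold.maximalAtlas (𝓡 2) ∞ M, ∀ A, IsFirstOrderFrame f e A →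
    ∀ u ∈ e.target, ∀ i j k, a3 A u i j k = 0

section Envelope

variable {F : Type*} [NormedAddCommGroup F] [NormedSpace ℝ F]

/-- A piece `N` of a surface (in coordinates) is the envelope of a one-parameter family of spheres
`S τ`: the sphere `S (t u)` touches the surface at `u`. Spheres are given by vectors of
homogeneous coordinates in `F`; the family is smooth and regular (`S` and `S'` are independent),
and the characteristics are the level curves of the submersion `t`. -/
def IsEnvelope (isSphere : F → Prop) (touches : F → E2 → Prop) (N : Set E2) (t : E2 → ℝ) : Prop :=
  ContDiffOn ℝ ∞ t N ∧ (∀ u ∈ N, fderiv ℝ t u ≠ 0) ∧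
    ∃ S : ℝ → F, ContDiffOn ℝ ∞ S (t '' N) ∧
      (∀ τ ∈ t '' N, isSphere (S τ) ∧ LinearIndependent ℝ ![S τ, deriv S τ]) ∧
      ∀ u ∈ N, touches (S (t u)) u

variable (M) in
/-- Near each of its points the surface is the envelope of two one-parameter families of spheres
whose characteristics are transversal. -/
def IsTwiceEnvelope (isSphere : F → Prop)
    (touches : OpenPartialHomeomorph M E2 → F → E2 → Prop) : Prop :=
  ∀ e ∈ IsManifold.maximalAtlas (𝓡 2) ∞ M, ∀ u ∈ e.target,
    ∃ N ⊆ e.target, IsOpen N ∧ u ∈ N ∧ ∃ t₁ t₂ : E2 → ℝ,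
      IsEnvelope isSphere (touches e) N t₁ ∧ IsEnvelope isSphere (touches e) N t₂ ∧
      ∀ w ∈ N, LinearIndependent ℝ ![fderiv ℝ t₁ w, fderiv ℝ t₂ w]

/-- The surface is 1-canal with respect to all its principal directions: near each point, and for
each principal direction there, it is the envelope of a one-parameter family of spheres whose
characteristic through the point has that direction. -/
def IsCanalAlongPrincipal (f : M → C3) (isSphere : F → Prop)
    (touches : OpenPartialHomeomorph M E2 → F → E2 → Prop) : Prop :=
  ∀ e ∈ IsManifold.maximalAtlas (𝓡 2) ∞ M, ∀ A, IsFirstOrderFrame f e A →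
    ∀ u ∈ e.target, ∀ v, IsPrincipal A u v →
      ∃ N ⊆ e.target, IsOpen N ∧ u ∈ N ∧ ∃ t : E2 → ℝ,
        IsEnvelope isSphere (touches e) N t ∧ fderiv ℝ t u v = 0

end Envelope

/-! Conformal space -/

/-- The vector `S` represents a sphere of the conformal space. -/
def IsSphere (S : Poly) : Prop := 0 < form S S

/-- The sphere `S` touches the surface `f` at the point with coordinates `u`. -/
def Touches (f : M → C3) (e : OpenPartialHomeomorph M E2) (S : Poly) (u : E2) : Prop :=
  form S (lift (f (e.symm u))) = 0 ∧
    ∀ v, form S (fderiv ℝ (fun w => lift (f (e.symm w))) u v) = 0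

/-- The surface `f` in the conformal space is a Dupin cyclide (or an open part of one). -/
def IsDupinCyclide (f : M → C3) : Prop := IsTwiceEnvelope M IsSphere (Touches f)

/-- The surface `f` in the conformal space is 1-canal with respect to its principal directions. -/
def IsCanal (f : M → C3) : Prop := IsCanalAlongPrincipal f IsSphere (Touches f)

/-! Euclidean space -/

/-- `q = (c, m, d)` represents the locus `c ‖y‖² - 2 ⟪m, y⟫ + d = 0`, a sphere (`c ≠ 0`) or
a plane (`c = 0`) of Euclidean space. -/
def IsSphereE (q : ℝ × E3 × ℝ) : Prop := q.1 * q.2.2 < ‖q.2.1‖ ^ 2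

/-- The sphere or plane `q` touches the surface `φ` at the point with coordinates `u`. -/
def TouchesE (φ : M → E3) (e : OpenPartialHomeomorph M E2) (q : ℝ × E3 × ℝ) (u : E2) : Prop :=
  q.1 * ‖φ (e.symm u)‖ ^ 2 - 2 * ⟪q.2.1, φ (e.symm u)⟫ + q.2.2 = 0 ∧
    ∀ v, ⟪q.1 • φ (e.symm u) - q.2.1, fderiv ℝ (fun w => φ (e.symm w)) u v⟫ = 0

/-- Inverse stereographic projection, the conformal embedding of Euclidean space into `C3`. -/
def toConformal (y : E3) : C3 :=
  ⟨!₂[2 * y 0 / (‖y‖ ^ 2 + 1), 2 * y 1 / (‖y‖ ^ 2 + 1), 2 * y 2 / (‖y‖ ^ 2 + 1),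
      (‖y‖ ^ 2 - 1) / (‖y‖ ^ 2 + 1)], by
    have h : ‖y‖ ^ 2 = y 0 ^ 2 + y 1 ^ 2 + y 2 ^ 2 := by
      simp [EuclideanSpace.norm_sq_eq, Fin.sum_univ_three]
    have hp : ‖y‖ ^ 2 + 1 ≠ 0 := by positivity
    rw [mem_sphere_zero_iff_norm, EuclideanSpace.norm_eq, Real.sqrt_eq_one]
    simp only [Fin.sum_univ_four, Real.norm_eq_abs, sq_abs]
    simp
    field_simp
    rw [h]
    ring⟩

/-- The surface `φ` in Euclidean space is a Dupin cyclide (or an open part of one). -/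
def IsDupinCyclideE (φ : M → E3) : Prop := IsTwiceEnvelope M IsSphereE (TouchesE φ)

/-- The surface `φ` in Euclidean space is 1-canal with respect to its principal directions. -/
def IsCanalE (φ : M → E3) : Prop :=
  IsCanalAlongPrincipal (toConformal ∘ φ) IsSphereE (TouchesE φ)

end ConformalSurface

end

noncomputable section

namespace ConformalSurface

/-! ### Calculus of the scalar product of signature (4,1) -/

section Form

/-! The spheres touching the surface at a point are, up to scale, `A_3 + s A_0` together with the
point `A_0` as a degenerate member. A family of spheres enveloped by the surface is therefore a
function s such that `A_3 + s A_0` does not change along the characteristics. This vector is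
stationary in a direction v exactly when (λ - s g) v = 0, so that v is principal with curvature s,
and the form ds + s ω_0^0 + ω_3^0 vanishes on v (`fderiv_sphere_eq_zero_iff`). Differentiating det(λ
- s g) = 0 along v turns the second condition, away from umbilics, into λ_{ijk} v^i v^j v^k = 0
(`trilin_lam3_eq`). Hence the characteristics of an enveloped family are lines of curvature on which
the cubic form λ_{ijk} vanishes (`principal_of_isEnvelope`).

The rest of the forward direction is algebra at a point. As a_{ij} is trace-free and nondegenerate,
its eigenvalues relative to g are s and -s with s ≠ 0, and the eigenvectors x, y are g-orthogonal.
The correction terms in a_{ijk} vanish on (x,x,x) and (y,y,y) (`trilin_a3_self`), and μ is chosen so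
that the value on (x,x,y) is a multiple of λ(y,y,y) (`trilin_a3_mixed`). The Codazzi equations make
a_{ijk} totally symmetric, so it is zero as soon as λ_{ijk} vanishes on both principal vectors
(`a3_eq_zero`).

Conversely, if a_{ijk} = 0, both fields of curvature spheres are constant to first order along their
own principal direction. Their derivative has rank one, because the other principal direction moves
the sphere, so each field factors locally through a submersion to the line
(`exists_factor_of_rank_one`): the surface envelops two families, with the two principal directions
as characteristics (`exists_isEnvelope_of_a3_eq_zero`). The equivalence with the 1-canal property
follows because transversal characteristics exhaust the principal directions, and because
transversality at one point persists nearby. The Euclidean case reduces to the conformal one through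
a linear isomorphism between coordinates of spheres that preserves contact
(`isEnvelope_toConformal_iff`). -/

lemma form_comm (X Y : Poly) : form X Y = form Y X := by
  simp only [form]; ring

lemma form_add_left (X Y Z : Poly) : form (X + Y) Z = form X Z + form Y Z := by
  simp only [form, Pi.add_apply]; ring

lemma form_smul_left (c : ℝ) (X Y : Poly) : form (c • X) Y = c * form X Y := by
  simp only [form, Pi.smul_apply, smul_eq_mul]; ring

lemma form_add_right (X Y Z : Poly) : form X (Y + Z) = form X Y + form X Z := by
  simp only [form, Pi.add_apply]; ring

lemma form_smul_right (c : ℝ) (X Y : Poly) : form X (c • Y) = c * form X Y := by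
  simp only [form, Pi.smul_apply, smul_eq_mul]; ring

lemma form_zero_left (X : Poly) : form 0 X = 0 := by simp [form]

lemma _root_.ContDiffOn.form {n : WithTop ℕ∞} {P Q : E2 → Poly} {U : Set E2}
    (hP : ContDiffOn ℝ n P U) (hQ : ContDiffOn ℝ n Q U) :
    ContDiffOn ℝ n (fun u => form (P u) (Q u)) U := by
  rw [contDiffOn_pi] at hP hQ
  unfold ConformalSurface.form
  exact (((((hP 0).mul (hQ 0)).add ((hP 1).mul (hQ 1))).add ((hP 2).mul (hQ 2))).add
    ((hP 3).mul (hQ 3))).sub ((hP 4).mul (hQ 4))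

lemma fderiv_form_apply {P Q : E2 → Poly} {u : E2} (hP : DifferentiableAt ℝ P u)
    (hQ : DifferentiableAt ℝ Q u) (v : E2) :
    fderiv ℝ (fun w => form (P w) (Q w)) u v
      = form (fderiv ℝ P u v) (Q u) + form (P u) (fderiv ℝ Q u v) := by
  have h1 := hasFDerivAt_pi'.1 hP.hasFDerivAt
  have h2 := hasFDerivAt_pi'.1 hQ.hasFDerivAt
  have := ((((((h1 0).mul (h2 0)).add ((h1 1).mul (h2 1))).add ((h1 2).mul (h2 2))).add
    ((h1 3).mul (h2 3))).sub ((h1 4).mul (h2 4)))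
  have h : fderiv ℝ (fun w => form (P w) (Q w)) u = _ := this.fderiv
  rw [h]
  simp [form]
  ring

/-- A relation `(P, Q) = c` along an open set can be differentiated. -/
lemma form_fderiv_eq_zero {P Q : E2 → Poly} {U : Set E2} (hU : IsOpen U) {c : ℝ}
    (hP : DifferentiableOn ℝ P U) (hQ : DifferentiableOn ℝ Q U)
    (h : ∀ u ∈ U, form (P u) (Q u) = c) {u : E2} (hu : u ∈ U) (v : E2) :
    form (fderiv ℝ P u v) (Q u) + form (P u) (fderiv ℝ Q u v) = 0 := by
  have hn := hU.mem_nhds hu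
  rw [← fderiv_form_apply (hP.differentiableAt hn) (hQ.differentiableAt hn)]
  have : (fun w => form (P w) (Q w)) =ᶠ[nhds u] fun _ => c := by
    filter_upwards [hn] with w hw using h w hw
  rw [this.fderiv_eq]; simp

end Form

/-! ### Smoothness of determinants and inverse matrices -/

section MatrixSmooth

variable {E : Type*} [NormedAddCommGroup E] [NormedSpace ℝ E] {n : Type*} [Fintype n]
  [DecidableEq n] {k : WithTop ℕ∞} {s : Set E}

lemma contDiffOn_det {M : E → Matrix n n ℝ} (hM : ∀ i j, ContDiffOn ℝ k (fun x => M x i j) s) :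
    ContDiffOn ℝ k (fun x => (M x).det) s := by
  simp only [Matrix.det_apply']
  exact ContDiffOn.sum fun σ _ => contDiffOn_const.mul (contDiffOn_prod fun i _ => hM _ _)

lemma contDiffOn_inv_apply {M : E → Matrix n n ℝ}
    (hM : ∀ i j, ContDiffOn ℝ k (fun x => M x i j) s) (hd : ∀ x ∈ s, (M x).det ≠ 0) (i j : n) :
    ContDiffOn ℝ k (fun x => (M x)⁻¹ i j) s := by
  simp only [Matrix.inv_def, Matrix.smul_apply, smul_eq_mul, Ring.inverse_eq_inv',
    Matrix.adjugate_apply]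
  refine ((contDiffOn_det hM).inv hd).mul (contDiffOn_det fun a b => ?_)
  by_cases h : a = j
  · subst h; simp only [Matrix.updateRow_self]; exact contDiffOn_const
  · simp only [Matrix.updateRow_ne h]; exact hM a b

end MatrixSmooth

/-! ### First-order frames in coordinates and the forms ω_ξ^η -/

/-- A smooth field of first-order conformal frames over an open set of the coordinate plane, along
an immersed surface. -/
structure IsFrameOn (U : Set E2) (A : Fin 5 → E2 → Poly) : Prop where
  isOpen : IsOpen U
  smooth : ∀ ξ, ContDiffOn ℝ ∞ (A ξ) U
  null_zero : ∀ u ∈ U, form (A 0 u) (A 0 u) = 0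
  null_four : ∀ u ∈ U, form (A 4 u) (A 4 u) = 0
  zero_four : ∀ u ∈ U, form (A 0 u) (A 4 u) = -1
  zero_three : ∀ u ∈ U, form (A 0 u) (A 3 u) = 0
  four_three : ∀ u ∈ U, form (A 4 u) (A 3 u) = 0
  three_three : ∀ u ∈ U, form (A 3 u) (A 3 u) = 1
  zero_tg : ∀ u ∈ U, ∀ i, form (A 0 u) (A (tg i) u) = 0
  four_tg : ∀ u ∈ U, ∀ i, form (A 4 u) (A (tg i) u) = 0
  tg_three : ∀ u ∈ U, ∀ i, form (A (tg i) u) (A 3 u) = 0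
  metric : ∀ u ∈ U, (g A u).PosDef
  tangent : ∀ u ∈ U, ∀ v, form (fderiv ℝ (A 0) u v) (A 3 u) = 0
  immersed : ∀ u ∈ U, ∀ v, (∃ c : ℝ, fderiv ℝ (A 0) u v = c • A 0 u) → v = 0

namespace IsFrameOn

variable {U : Set E2} {A : Fin 5 → E2 → Poly} (hA : IsFrameOn U A) {u : E2} (hu : u ∈ U)
include hA

lemma differentiableOn (ξ : Fin 5) : DifferentiableOn ℝ (A ξ) U :=
  (hA.smooth ξ).differentiableOn (by simp)

include hu

lemma zero_one : form (A 0 u) (A 1 u) = 0 := hA.zero_tg u hu 0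
lemma zero_two : form (A 0 u) (A 2 u) = 0 := hA.zero_tg u hu 1
lemma four_one : form (A 4 u) (A 1 u) = 0 := hA.four_tg u hu 0
lemma four_two : form (A 4 u) (A 2 u) = 0 := hA.four_tg u hu 1
lemma one_three : form (A 1 u) (A 3 u) = 0 := hA.tg_three u hu 0
lemma two_three : form (A 2 u) (A 3 u) = 0 := hA.tg_three u hu 1

omit hA hu in
lemma _root_.ConformalSurface.g_symm (A : Fin 5 → E2 → Poly) (u : E2) (i j : Fin 2) :
    g A u i j = g A u j i := form_comm _ _

lemma g_det_pos : 0 < (g A u).det := (hA.metric u hu).det_pos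

lemma g_det_pos' : 0 < g A u 0 0 * g A u 1 1 - g A u 0 1 * g A u 0 1 := by
  have := hA.g_det_pos hu
  rwa [Matrix.det_fin_two, g_symm A u 1 0] at this

lemma g_zero_zero_pos : 0 < g A u 0 0 := (hA.metric u hu).diag_pos

/-- Inner products of a combination of the frame vectors with the frame vectors. -/
lemma form_combination (c : Fin 5 → ℝ) :
    form (∑ ξ, c ξ • A ξ u) (A 0 u) = - c 4 ∧ form (∑ ξ, c ξ • A ξ u) (A 4 u) = - c 0 ∧
    form (∑ ξ, c ξ • A ξ u) (A 3 u) = c 3 ∧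
    ∀ j, form (∑ ξ, c ξ • A ξ u) (A (tg j) u) = ∑ i, c (tg i) * g A u i j := by
  have h00 := hA.null_zero u hu
  have h44 := hA.null_four u hu
  have h04 := hA.zero_four u hu
  have h03 := hA.zero_three u hu
  have h43 := hA.four_three u hu
  have h33 := hA.three_three u hu
  have h01 := hA.zero_one hu
  have h02 := hA.zero_two hu
  have h41 := hA.four_one hu
  have h42 := hA.four_two hu
  have h13 := hA.one_three hu
  have h23 := hA.two_three hu
  refine ⟨?_, ?_, ?_, fun j => ?_⟩
  all_goals simp only [Fin.sum_univ_five, form_add_left, form_smul_left]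
  · rw [h00, form_comm (A 1 u), h01, form_comm (A 2 u), h02, form_comm (A 3 u), h03,
      form_comm (A 4 u), h04]; ring
  · rw [h04, form_comm (A 1 u), h41, form_comm (A 2 u), h42, form_comm (A 3 u), h43, h44]; ring
  · rw [h03, h13, h23, h33, h43]; ring
  · rw [hA.zero_tg u hu, hA.four_tg u hu, form_comm (A 3 u), hA.tg_three u hu]
    simp [Fin.sum_univ_two, g, tg]

/-- Pairing with `A_0`, `A_3`, `A_4` isolates three of the coefficients; the pairings with `A_1`,
`A_2` give a linear system for the other two with determinant det g > 0. -/
lemma combination_eq_zero {c : Fin 5 → ℝ} (hc : ∑ ξ, c ξ • A ξ u = 0) : c = 0 := by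
  obtain ⟨h0, h4, h3, ht⟩ := hA.form_combination hu c
  rw [hc, form_zero_left] at h0 h4 h3
  have ht0 := ht 0
  have ht1 := ht 1
  have hd := hA.g_det_pos' hu
  simp only [hc, form_zero_left, Fin.sum_univ_two, tg, Matrix.cons_val_zero,
    Matrix.cons_val_one, g_symm A u 1 0] at ht0 ht1
  have h1 : c 1 = 0 := by
    have : c 1 * (g A u 0 0 * g A u 1 1 - g A u 0 1 * g A u 0 1) = 0 := by
      linear_combination - g A u 1 1 * ht0 + g A u 0 1 * ht1
    exact (mul_eq_zero.1 this).resolve_right hd.ne'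
  have h2 : c 2 = 0 := by
    have : c 2 * (g A u 0 0 * g A u 1 1 - g A u 0 1 * g A u 0 1) = 0 := by
      linear_combination g A u 0 1 * ht0 - g A u 0 0 * ht1
    exact (mul_eq_zero.1 this).resolve_right hd.ne'
  funext ξ
  fin_cases ξ <;> simp <;> linarith

lemma combination_injective {c d : Fin 5 → ℝ} (h : ∑ ξ, c ξ • A ξ u = ∑ ξ, d ξ • A ξ u) :
    c = d := by
  refine sub_eq_zero.1 (hA.combination_eq_zero hu ?_)
  simp [sub_smul, h]

lemma isUnit_det : IsUnit (Matrix.of fun ξ => A ξ u).det := by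
  rw [← Matrix.isUnit_iff_isUnit_det, ← Matrix.vecMul_injective_iff_isUnit]
  intro c d h
  refine hA.combination_injective hu ?_
  simp only [Matrix.vecMul_eq_sum] at h
  exact h

/-- `dA_ξ = ω_ξ^η A_η`. -/
lemma fderiv_eq (ξ : Fin 5) (v : E2) :
    fderiv ℝ (A ξ) u v = ∑ η, omega A u v ξ η • A η u := by
  have h : omega A u v * (Matrix.of fun ξ => A ξ u) = Matrix.of fun ξ => fderiv ℝ (A ξ) u v := by
    rw [omega, Matrix.mul_assoc, Matrix.nonsing_inv_mul _ (hA.isUnit_det hu), Matrix.mul_one]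
  have := congrFun h ξ
  funext k
  have := congrFun this k
  simp only [Matrix.mul_apply, Matrix.of_apply] at this
  rw [← this]; simp

omit hu hA in
lemma _root_.ConformalSurface.omega_add (A : Fin 5 → E2 → Poly) (u v w : E2) :
    omega A u (v + w) = omega A u v + omega A u w := by
  simp only [omega, ← Matrix.add_mul]; congr 1; ext; simp

omit hu hA in
lemma _root_.ConformalSurface.omega_smul (A : Fin 5 → E2 → Poly) (u v : E2) (c : ℝ) :
    omega A u (c • v) = c • omega A u v := by
  simp only [omega, ← Matrix.smul_mul]; congr 1; ext; simp

/-- The values of the forms `ω_ξ^η` in terms of inner products. -/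
lemma form_fderiv (ξ : Fin 5) (v : E2) :
    form (fderiv ℝ (A ξ) u v) (A 0 u) = - omega A u v ξ 4 ∧
    form (fderiv ℝ (A ξ) u v) (A 4 u) = - omega A u v ξ 0 ∧
    form (fderiv ℝ (A ξ) u v) (A 3 u) = omega A u v ξ 3 ∧
    ∀ j, form (fderiv ℝ (A ξ) u v) (A (tg j) u) = ∑ i, omega A u v ξ (tg i) * g A u i j := by
  rw [hA.fderiv_eq hu]
  exact hA.form_combination hu fun η => omega A u v ξ η

lemma omega_zero_three (v : E2) : omega A u v 0 3 = 0 := by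
  rw [← (hA.form_fderiv hu 0 v).2.2.1, hA.tangent u hu]

/-- From here through `omega_tg_three`, a constant product of two frame vectors is differentiated: ω
is skew with respect to the Gram matrix of the frame. The tangency condition enters through ω_0^3 =
0. -/
lemma omega_zero_four (v : E2) : omega A u v 0 4 = 0 := by
  have h := form_fderiv_eq_zero hA.isOpen (hA.differentiableOn 0) (hA.differentiableOn 0)
    hA.null_zero hu v
  rw [form_comm (A 0 u), (hA.form_fderiv hu 0 v).1] at h
  linarith

lemma omega_three_three (v : E2) : omega A u v 3 3 = 0 := by
  have h := form_fderiv_eq_zero hA.isOpen (hA.differentiableOn 3) (hA.differentiableOn 3)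
    hA.three_three hu v
  rw [form_comm (A 3 u), (hA.form_fderiv hu 3 v).2.2.1] at h
  linarith

lemma omega_three_four (v : E2) : omega A u v 3 4 = 0 := by
  have h := form_fderiv_eq_zero hA.isOpen (hA.differentiableOn 0) (hA.differentiableOn 3)
    hA.zero_three hu v
  rw [form_comm (A 0 u), (hA.form_fderiv hu 3 v).1, (hA.form_fderiv hu 0 v).2.2.1,
    hA.omega_zero_three hu] at h
  linarith

lemma omega_four_three (v : E2) : omega A u v 4 3 = omega A u v 3 0 := by
  have h := form_fderiv_eq_zero hA.isOpen (hA.differentiableOn 4) (hA.differentiableOn 3)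
    hA.four_three hu v
  rw [form_comm (A 4 u), (hA.form_fderiv hu 3 v).2.1, (hA.form_fderiv hu 4 v).2.2.1] at h
  linarith

lemma omega_tg_four (i : Fin 2) (v : E2) :
    omega A u v (tg i) 4 = ∑ j, g A u i j * omega A u v 0 (tg j) := by
  have h := form_fderiv_eq_zero hA.isOpen (hA.differentiableOn 0) (hA.differentiableOn (tg i))
    (fun u hu => hA.zero_tg u hu i) hu v
  rw [form_comm (A 0 u), (hA.form_fderiv hu (tg i) v).1, (hA.form_fderiv hu 0 v).2.2.2] at h
  rw [← sub_eq_zero, ← neg_eq_zero]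
  rw [← h, neg_sub, sub_eq_add_neg]
  congr 1
  exact Finset.sum_congr rfl fun j _ => by rw [g_symm, mul_comm]

lemma omega_tg_three (i : Fin 2) (v : E2) :
    omega A u v (tg i) 3 = - ∑ j, g A u i j * omega A u v 3 (tg j) := by
  have h := form_fderiv_eq_zero hA.isOpen (hA.differentiableOn (tg i)) (hA.differentiableOn 3)
    (fun u hu => hA.tg_three u hu i) hu v
  rw [form_comm (A (tg i) u), (hA.form_fderiv hu (tg i) v).2.2.1,
    (hA.form_fderiv hu 3 v).2.2.2] at h
  rw [eq_neg_iff_add_eq_zero, ← h]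
  congr 1
  exact Finset.sum_congr rfl fun j _ => by rw [g_symm, mul_comm]

lemma fderiv_g (i j : Fin 2) (v : E2) :
    fderiv ℝ (fun w => g A w i j) u v
      = ∑ k, (omega A u v (tg i) (tg k) * g A u k j + omega A u v (tg j) (tg k) * g A u i k) := by
  have hn := hA.isOpen.mem_nhds hu
  have : fderiv ℝ (fun w => g A w i j) u v = _ :=
    fderiv_form_apply ((hA.differentiableOn (tg i)).differentiableAt hn)
      ((hA.differentiableOn (tg j)).differentiableAt hn) v
  rw [this, form_comm (A (tg i) u), (hA.form_fderiv hu (tg i) v).2.2.2,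
    (hA.form_fderiv hu (tg j) v).2.2.2, ← Finset.sum_add_distrib]
  exact Finset.sum_congr rfl fun k _ => by rw [g_symm A u k i]

/-- A vector killed by ω^1 and ω^2 moves `A_0` only along itself, since ω_0^3 = ω_0^4 = 0; the
immersion condition excludes this. -/
lemma coframe_det_ne_zero : (coframe A u).det ≠ 0 := by
  intro h
  obtain ⟨c, hc, h⟩ := Matrix.exists_mulVec_eq_zero_iff.2 h
  apply hc
  have key : ∀ i, omega A u (∑ k, c k • EuclideanSpace.single k (1 : ℝ)) 0 (tg i) = 0 := by
    intro i
    have := congrFun h i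
    simp only [Matrix.mulVec, dotProduct, coframe, Matrix.of_apply, Fin.sum_univ_two,
      Pi.zero_apply] at this
    simp only [Fin.sum_univ_two, omega_add, omega_smul, Matrix.add_apply, Matrix.smul_apply,
      smul_eq_mul]
    linarith
  have hv := hA.immersed u hu (∑ k, c k • EuclideanSpace.single k (1 : ℝ))
    ⟨omega A u (∑ k, c k • EuclideanSpace.single k (1 : ℝ)) 0 0, by
      have h1 := key 0
      have h2 := key 1
      simp only [tg, Matrix.cons_val_zero, Matrix.cons_val_one] at h1 h2
      rw [hA.fderiv_eq hu, Fin.sum_univ_five, h1, h2, hA.omega_zero_three hu,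
        hA.omega_zero_four hu]
      simp⟩
  funext i
  have := congrFun (congrArg (fun x : E2 => (x : Fin 2 → ℝ)) hv) i
  fin_cases i <;> simpa [Fin.sum_univ_two] using this

lemma omega_dual (i j : Fin 2) : omega A u (dual A u j) 0 (tg i) = if i = j then 1 else 0 := by
  have h := Matrix.mul_nonsing_inv (coframe A u) (hA.coframe_det_ne_zero hu).isUnit
  have := congrFun (congrFun h i) j
  rw [Matrix.one_apply, Matrix.mul_apply] at this
  rw [← this]
  simp only [dual, Fin.sum_univ_two, omega_add, omega_smul, Matrix.add_apply, Matrix.smul_apply,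
      smul_eq_mul, coframe, Matrix.of_apply]
  ring

/-- The components `ω^i(v)` determine the vector `v`. -/
lemma eq_zero_of_omega {v : E2} (hv : ∀ i, omega A u v 0 (tg i) = 0) : v = 0 :=
  hA.immersed u hu v ⟨omega A u v 0 0, by
      have h1 := hv 0
      have h2 := hv 1
      simp only [tg, Matrix.cons_val_zero, Matrix.cons_val_one] at h1 h2
      rw [hA.fderiv_eq hu, Fin.sum_univ_five, h1, h2, hA.omega_zero_three hu,
        hA.omega_zero_four hu]
      simp⟩

lemma eq_sum_dual (v : E2) : v = ∑ j, omega A u v 0 (tg j) • dual A u j := by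
  rw [← sub_eq_zero]
  refine hA.eq_zero_of_omega hu fun i => ?_
  have h : ∀ j, omega A u (dual A u j) 0 (tg i) = if i = j then 1 else 0 := hA.omega_dual hu i
  rw [sub_eq_add_neg, ← neg_one_smul ℝ (∑ j, _)]
  simp only [Fin.sum_univ_two, omega_add, omega_smul, Matrix.add_apply, Matrix.smul_apply,
      smul_eq_mul, h]
  fin_cases i <;> simp

/-- `ω_i^3 = λ_{ij} ω^j`. -/
lemma omega_tg_three_eq (i : Fin 2) (v : E2) :
    omega A u v (tg i) 3 = ∑ j, lam A u i j * omega A u v 0 (tg j) := by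
  conv_lhs => rw [hA.eq_sum_dual hu v]
  simp only [Fin.sum_univ_two, omega_add, omega_smul, Matrix.add_apply, Matrix.smul_apply,
      smul_eq_mul, lam, Matrix.of_apply]
  ring

end IsFrameOn

/-! ### Smoothness of the invariants, structure equations and Codazzi equations -/

namespace IsFrameOn

variable {U : Set E2} {A : Fin 5 → E2 → Poly} (hA : IsFrameOn U A) {u : E2} (hu : u ∈ U)
include hA

lemma contDiffOn_fderiv (ξ : Fin 5) : ContDiffOn ℝ ∞ (fderiv ℝ (A ξ)) U :=
  (hA.smooth ξ).fderiv_of_isOpen hA.isOpen (by simp)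

lemma contDiffOn_omega (v : E2) (ξ η : Fin 5) :
    ContDiffOn ℝ ∞ (fun u => omega A u v ξ η) U := by
  simp only [omega, Matrix.mul_apply, Matrix.of_apply]
  refine ContDiffOn.sum fun k _ => ContDiffOn.mul ?_ ?_
  · exact contDiffOn_pi.1 ((hA.contDiffOn_fderiv ξ).clm_apply contDiffOn_const) k
  · exact contDiffOn_inv_apply (fun i j => contDiffOn_pi.1 (hA.smooth i) j)
      (fun u hu => (hA.isUnit_det hu).ne_zero) k η

lemma contDiffOn_g (i j : Fin 2) : ContDiffOn ℝ ∞ (fun u => g A u i j) U :=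
  (hA.smooth (tg i)).form (hA.smooth (tg j))

lemma contDiffOn_lam (i j : Fin 2) : ContDiffOn ℝ ∞ (fun u => lam A u i j) U := by
  have h (u : E2) : lam A u i j = ∑ k, (coframe A u)⁻¹ k j *
      omega A u (EuclideanSpace.single k 1) (tg i) 3 := by
    simp only [lam, dual, Fin.sum_univ_two, omega_add, omega_smul, Matrix.add_apply,
      Matrix.smul_apply, smul_eq_mul, Matrix.of_apply]
  simp only [h]
  refine ContDiffOn.sum fun k _ => ContDiffOn.mul ?_ (hA.contDiffOn_omega _ _ _)
  exact contDiffOn_inv_apply (fun i j => hA.contDiffOn_omega _ _ _)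
    (fun u hu => hA.coframe_det_ne_zero hu) k j

lemma contDiffOn_g_inv (i j : Fin 2) : ContDiffOn ℝ ∞ (fun u => (g A u)⁻¹ i j) U :=
  contDiffOn_inv_apply hA.contDiffOn_g (fun _ hu => (hA.g_det_pos hu).ne') i j

omit hA in
/-- The mean curvature `λ = (1/2) g^{ij} λ_{ij}`. -/
def _root_.ConformalSurface.meanLam (A : Fin 5 → E2 → Poly) (u : E2) : ℝ :=
  (1 / 2 : ℝ) * ∑ i, ∑ j, (g A u)⁻¹ i j * lam A u i j

lemma contDiffOn_meanLam : ContDiffOn ℝ ∞ (meanLam A) U :=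
  contDiffOn_const.mul (ContDiffOn.sum fun i _ => ContDiffOn.sum fun j _ =>
    (hA.contDiffOn_g_inv i j).mul (hA.contDiffOn_lam i j))

omit hA in
lemma _root_.ConformalSurface.a2_apply (A : Fin 5 → E2 → Poly) (u : E2) (i j : Fin 2) :
    a2 A u i j = lam A u i j - meanLam A u * g A u i j := rfl

lemma contDiffOn_a2 (i j : Fin 2) : ContDiffOn ℝ ∞ (fun u => a2 A u i j) U := by
  simp only [a2_apply]
  exact (hA.contDiffOn_lam i j).sub (hA.contDiffOn_meanLam.mul (hA.contDiffOn_g i j))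

include hu

lemma differentiableAt_omega (v : E2) (ξ η : Fin 5) :
    DifferentiableAt ℝ (fun u => omega A u v ξ η) u :=
  ((hA.contDiffOn_omega v ξ η).differentiableOn (by simp)).differentiableAt
    (hA.isOpen.mem_nhds hu)

lemma differentiableAt_lam (i j : Fin 2) : DifferentiableAt ℝ (fun u => lam A u i j) u :=
  ((hA.contDiffOn_lam i j).differentiableOn (by simp)).differentiableAt (hA.isOpen.mem_nhds hu)

lemma differentiableAt_g (i j : Fin 2) : DifferentiableAt ℝ (fun u => g A u i j) u :=
  ((hA.contDiffOn_g i j).differentiableOn (by simp)).differentiableAt (hA.isOpen.mem_nhds hu)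

/-- Differentiate dA_ξ = ω_ξ^η A_η once more. The direction w is a constant field, so no bracket
appears, and symmetry of the second derivative yields the structure equations. -/
lemma sndFDeriv_eq (ξ : Fin 5) (z w : E2) :
    fderiv ℝ (fderiv ℝ (A ξ)) u z w = ∑ ζ, (fderiv ℝ (fun x => omega A x w ξ ζ) u z
      + ∑ η, omega A u w ξ η * omega A u z η ζ) • A ζ u := by
  have hn := hA.isOpen.mem_nhds hu
  have hd : DifferentiableAt ℝ (fderiv ℝ (A ξ)) u :=
    ((hA.contDiffOn_fderiv ξ).differentiableOn (by simp)).differentiableAt hn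
  have h1 : fderiv ℝ (fun x => fderiv ℝ (A ξ) x w) u z = fderiv ℝ (fderiv ℝ (A ξ)) u z w := by
    rw [fderiv_clm_apply hd (differentiableAt_const w)]
    simp
  have h2 : (fun x => fderiv ℝ (A ξ) x w) =ᶠ[nhds u] fun x => ∑ η, omega A x w ξ η • A η x := by
    filter_upwards [hn] with x hx using hA.fderiv_eq hx ξ w
  rw [← h1, h2.fderiv_eq]
  have h3 : ∀ η, DifferentiableAt ℝ (fun x => omega A x w ξ η • A η x) u := fun η =>
    (hA.differentiableAt_omega hu w ξ η).smul ((hA.differentiableOn η).differentiableAt hn)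
  rw [fderiv_fun_sum fun η _ => h3 η]
  have h4 : ∀ η, fderiv ℝ (fun x => omega A x w ξ η • A η x) u z
      = fderiv ℝ (fun x => omega A x w ξ η) u z • A η u
        + ∑ ζ, (omega A u w ξ η * omega A u z η ζ) • A ζ u := fun η => by
    rw [fderiv_fun_smul (hA.differentiableAt_omega hu w ξ η)
      ((hA.differentiableOn η).differentiableAt hn)]
    simp only [add_apply, smul_apply,
      ContinuousLinearMap.smulRight_apply]
    rw [hA.fderiv_eq hu, Finset.smul_sum, add_comm]
    simp only [smul_smul]
  simp only [_root_.sum_apply, h4, add_smul, Finset.sum_add_distrib, Finset.sum_smul]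
  rw [Finset.sum_comm]

/-- The structure equations `dω_ξ^ζ = ω_ξ^η ∧ ω_η^ζ`. -/
lemma structure_eq (ξ ζ : Fin 5) (z w : E2) :
    fderiv ℝ (fun x => omega A x w ξ ζ) u z + ∑ η, omega A u w ξ η * omega A u z η ζ
      = fderiv ℝ (fun x => omega A x z ξ ζ) u w + ∑ η, omega A u z ξ η * omega A u w η ζ := by
  have hsymm : IsSymmSndFDerivAt ℝ (A ξ) u :=
    ((hA.smooth ξ).contDiffAt (hA.isOpen.mem_nhds hu)).isSymmSndFDerivAt
      (by rw [minSmoothness_of_isRCLikeNormedField]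
          exact WithTop.coe_le_coe.2 (le_top : (2 : ℕ∞) ≤ ⊤))
  have := hsymm z w
  rw [hA.sndFDeriv_eq hu, hA.sndFDeriv_eq hu] at this
  exact congrFun (hA.combination_injective hu this) ζ

/-- Cartan's lemma: ω_0^3 = 0 gives ω^i ∧ ω_i^3 = 0, which is evaluated on the dual basis. -/
lemma lam_symm (i j : Fin 2) : lam A u i j = lam A u j i := by
  have h := hA.structure_eq hu 0 3 (dual A u 0) (dual A u 1)
  have h0 : ∀ w, fderiv ℝ (fun x => omega A x w 0 3) u = 0 := fun w => by
    have : (fun x => omega A x w 0 3) =ᶠ[nhds u] fun _ => 0 := by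
      filter_upwards [hA.isOpen.mem_nhds hu] with x hx using hA.omega_zero_three hx w
    rw [this.fderiv_eq]; simp
  have d00 := hA.omega_dual hu 0 0
  have d01 := hA.omega_dual hu 0 1
  have d10 := hA.omega_dual hu 1 0
  have d11 := hA.omega_dual hu 1 1
  simp only [tg, Matrix.cons_val_zero, Matrix.cons_val_one, if_true] at d00 d01 d10 d11
  simp only [h0, Fin.sum_univ_five, hA.omega_zero_three hu, hA.omega_zero_four hu, d00, d01, d10,
    d11] at h
  have key : lam A u 1 0 = lam A u 0 1 := by
    simpa [lam, tg] using h
  fin_cases i <;> fin_cases j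
  exacts [rfl, key.symm, key, rfl]

lemma fderiv_omega_tg_three (i : Fin 2) (z w : E2) :
    fderiv ℝ (fun x => omega A x w (tg i) 3) u z
      = ∑ j, (fderiv ℝ (fun x => lam A x i j) u z * omega A u w 0 (tg j)
          + lam A u i j * fderiv ℝ (fun x => omega A x w 0 (tg j)) u z) := by
  have h : (fun x => omega A x w (tg i) 3) =ᶠ[nhds u]
      fun x => ∑ j, lam A x i j * omega A x w 0 (tg j) := by
    filter_upwards [hA.isOpen.mem_nhds hu] with x hx using hA.omega_tg_three_eq hx i w
  have hd : ∀ j ∈ Finset.univ,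
      DifferentiableAt ℝ (fun x => lam A x i j * omega A x w 0 (tg j)) u := fun j _ =>
    (hA.differentiableAt_lam hu i j).mul (hA.differentiableAt_omega hu w 0 (tg j))
  rw [h.fderiv_eq, fderiv_fun_sum hd]
  simp only [sum_apply]
  refine Finset.sum_congr rfl fun j _ => ?_
  rw [fderiv_fun_mul (hA.differentiableAt_lam hu i j) (hA.differentiableAt_omega hu w 0 (tg j))]
  simp only [add_apply, smul_apply, smul_eq_mul]
  ring

/-- The Codazzi equations. -/
lemma lam3_symm_right (i j k : Fin 2) : lam3 A u i j k = lam3 A u i k j := by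
  have key : lam3 A u i 0 1 = lam3 A u i 1 0 := by
    -- `h3` is the structure equation of ω_i^3, and `h0`, `h1` eliminate dω^j from the derivative of
    -- λ_{ij} ω^j. The summand ω_i^4 ∧ ω_4^3 = g_{ij} ω^j ∧ ω_3^0 accounts for the term with g_{ij}
    -- in `lam3`.
    have h3 := hA.structure_eq hu (tg i) 3 (dual A u 0) (dual A u 1)
    have h0 := hA.structure_eq hu 0 (tg 0) (dual A u 0) (dual A u 1)
    have h1 := hA.structure_eq hu 0 (tg 1) (dual A u 0) (dual A u 1)
    rw [hA.fderiv_omega_tg_three hu, hA.fderiv_omega_tg_three hu] at h3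
    have e3 (w : E2) : omega A u w 1 3 = _ := hA.omega_tg_three_eq hu 0 w
    have e3' (w : E2) : omega A u w 2 3 = _ := hA.omega_tg_three_eq hu 1 w
    have ei4 := hA.omega_tg_four hu i
    have d00 := hA.omega_dual hu 0 0
    have d01 := hA.omega_dual hu 0 1
    have d10 := hA.omega_dual hu 1 0
    have d11 := hA.omega_dual hu 1 1
    have s := hA.lam_symm hu 1 0
    simp only [tg, Matrix.cons_val_zero, Matrix.cons_val_one, if_true] at d00 d01 d10 d11 h0 h1
    simp only [Fin.sum_univ_five, Fin.sum_univ_two, hA.omega_zero_three hu, hA.omega_zero_four hu,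
      hA.omega_four_three hu, hA.omega_three_three hu, tg,
      Matrix.cons_val_zero, Matrix.cons_val_one, d00, d01, d10, d11, e3, e3'] at h0 h1 h3 ei4
    simp only [lam3, Fin.sum_univ_two, tg, Matrix.cons_val_zero, Matrix.cons_val_one]
    rw [ei4, ei4, d00, d01, d10, d11] at h3
    norm_num at h0 h1 h3
    linear_combination -h3 + lam A u i 0 * h0 + lam A u i 1 * h1
  fin_cases j <;> fin_cases k
  exacts [rfl, key, key.symm, rfl]

lemma lam3_symm_left (i j k : Fin 2) : lam3 A u i j k = lam3 A u j i k := by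
  have h : (fun w => lam A w i j) =ᶠ[nhds u] fun w => lam A w j i := by
    filter_upwards [hA.isOpen.mem_nhds hu] with x hx using hA.lam_symm hx i j
  simp only [lam3, h.fderiv_eq, hA.lam_symm hu _ j, g_symm A u i j, hA.lam_symm hu i]
  ring

end IsFrameOn

/-! ### Algebra of symmetric forms in the plane -/

section Algebra

/-- The value of a trilinear form with the given components. -/
def trilin (T : Fin 2 → Fin 2 → Fin 2 → ℝ) (x y z : Fin 2 → ℝ) : ℝ :=
  ∑ i, ∑ j, ∑ k, T i j k * x i * y j * z k

/-- The value of a bilinear form with the given matrix. -/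
def bilin (B : Matrix (Fin 2) (Fin 2) ℝ) (x y : Fin 2 → ℝ) : ℝ :=
  ∑ i, ∑ j, B i j * x i * y j

/-- A symmetric trilinear form in the plane vanishes if it does so on the vectors of a basis. -/
lemma eq_zero_of_trilin {T : Fin 2 → Fin 2 → Fin 2 → ℝ} (hl : ∀ i j k, T i j k = T j i k)
    (hr : ∀ i j k, T i j k = T i k j) {x y : Fin 2 → ℝ} (hD : x 0 * y 1 - x 1 * y 0 ≠ 0)
    (hxxx : trilin T x x x = 0) (hxxy : trilin T x x y = 0) (hyyx : trilin T y y x = 0)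
    (hyyy : trilin T y y y = 0) (i j k : Fin 2) : T i j k = 0 := by
  have e010 : T 0 1 0 = T 0 0 1 := hr _ _ _
  have e100 : T 1 0 0 = T 0 0 1 := by rw [hl, hr]
  have e101 : T 1 0 1 = T 0 1 1 := hl _ _ _
  have e110 : T 1 1 0 = T 0 1 1 := by rw [hr, hl]
  simp only [trilin, Fin.sum_univ_two, e010, e100, e101, e110] at hxxx hxxy hyyx hyyy
  have hD3 := pow_ne_zero 3 hD
  -- With D = x_0 y_1 - x_1 y_0 one has D e_0 = y_1 x - x_1 y and D e_1 = x_0 y - y_0 x; the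
  -- coefficients here and below expand T on these vectors.
  have h0 : T 0 0 0 = 0 := by
    refine (mul_eq_zero.1 (?_ : (x 0 * y 1 - x 1 * y 0) ^ 3 * T 0 0 0 = 0)).resolve_left hD3
    linear_combination y 1 ^ 3 * hxxx - 3 * y 1 ^ 2 * x 1 * hxxy + 3 * y 1 * x 1 ^ 2 * hyyx
      - x 1 ^ 3 * hyyy
  have h1 : T 0 0 1 = 0 := by
    refine (mul_eq_zero.1 (?_ : (x 0 * y 1 - x 1 * y 0) ^ 3 * T 0 0 1 = 0)).resolve_left hD3
    linear_combination - y 1 ^ 2 * y 0 * hxxx + (y 1 ^ 2 * x 0 + 2 * y 1 * x 1 * y 0) * hxxy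
      + (- x 1 ^ 2 * y 0 - 2 * y 1 * x 1 * x 0) * hyyx + x 1 ^ 2 * x 0 * hyyy
  have h2 : T 0 1 1 = 0 := by
    refine (mul_eq_zero.1 (?_ : (x 0 * y 1 - x 1 * y 0) ^ 3 * T 0 1 1 = 0)).resolve_left hD3
    linear_combination y 0 ^ 2 * y 1 * hxxx - (y 0 ^ 2 * x 1 + 2 * y 0 * x 0 * y 1) * hxxy
      + (x 0 ^ 2 * y 1 + 2 * y 0 * x 0 * x 1) * hyyx - x 0 ^ 2 * x 1 * hyyy
  have h3 : T 1 1 1 = 0 := by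
    refine (mul_eq_zero.1 (?_ : (x 0 * y 1 - x 1 * y 0) ^ 3 * T 1 1 1 = 0)).resolve_left hD3
    linear_combination - y 0 ^ 3 * hxxx + 3 * y 0 ^ 2 * x 0 * hxxy - 3 * y 0 * x 0 ^ 2 * hyyx
      + x 0 ^ 3 * hyyy
  fin_cases i <;> fin_cases j <;> fin_cases k <;> simp [h0, h1, h2, h3, e010, e100, e101, e110]

/-- If a determinant of symmetric matrices of order two is stationary at a nonzero matrix, then the
derivative of the matrix vanishes on the kernel. -/
lemma kernel_of_stationary_det {b00 b01 b11 d00 d01 d11 x y : ℝ} (e0 : b00 * x + b01 * y = 0)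
    (e1 : b01 * x + b11 * y = 0) (hne : ¬ (b00 = 0 ∧ b01 = 0 ∧ b11 = 0))
    (hD : d00 * b11 + b00 * d11 - 2 * b01 * d01 = 0) :
    d00 * x ^ 2 + 2 * d01 * x * y + d11 * y ^ 2 = 0 := by
  -- With v = (x, y) ≠ 0 in the kernel, the adjugate of b is a multiple of v vᵀ, so the derivative
  -- of det b is that multiple of d(v, v). The three identities express this without division: each
  -- entry of b times d(v, v) is zero.
  by_contra hQ
  refine hne ⟨?_, ?_, ?_⟩ <;> refine (mul_eq_zero.1 ?_).resolve_right hQ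
  · linear_combination y ^ 2 * hD + d00 * (x * e0 - y * e1) + 2 * d01 * y * e0
  · linear_combination - x * y * hD + x * d00 * e1 + y * d11 * e0
  · linear_combination x ^ 2 * hD - d11 * (x * e0 - y * e1) + 2 * d01 * x * e1

end Algebra

/-! ### The derivative of a principal curvature along its own direction -/

namespace IsFrameOn

variable {U : Set E2} {A : Fin 5 → E2 → Poly} (hA : IsFrameOn U A) {u : E2} (hu : u ∈ U)
include hA hu

lemma lam3_apply (i j : Fin 2) (v : E2) :
    ∑ k, lam3 A u i j k * omega A u v 0 (tg k)
      = fderiv ℝ (fun w => lam A w i j) u v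
        - ∑ l, lam A u l j * omega A u v (tg i) (tg l)
        - ∑ l, lam A u i l * omega A u v (tg j) (tg l)
        + lam A u i j * omega A u v 0 0 + g A u i j * omega A u v 3 0 := by
  have h : ∀ ξ η, omega A u v ξ η = omega A u v 0 (tg 0) * omega A u (dual A u 0) ξ η
      + omega A u v 0 (tg 1) * omega A u (dual A u 1) ξ η := by
    intro ξ η
    conv_lhs => rw [hA.eq_sum_dual hu v]
    simp only [Fin.sum_univ_two, omega_add, omega_smul, Matrix.add_apply, Matrix.smul_apply,
      smul_eq_mul]
  have hd : fderiv ℝ (fun w => lam A w i j) u v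
      = omega A u v 0 (tg 0) * fderiv ℝ (fun w => lam A w i j) u (dual A u 0)
      + omega A u v 0 (tg 1) * fderiv ℝ (fun w => lam A w i j) u (dual A u 1) := by
    conv_lhs => rw [hA.eq_sum_dual hu v]
    simp only [Fin.sum_univ_two, map_add, map_smul, smul_eq_mul]
  rw [hd, h 0 0, h 3 0]
  simp only [Fin.sum_univ_two, h (tg i), h (tg j), lam3]
  ring

/-- If `s` is a principal curvature with principal vector `v`, then the sphere `A_3 + s A_0` is
stationary along `v` if and only if the form `λ_{ijk}` vanishes on `v`. -/
lemma trilin_lam3_eq {s : E2 → ℝ} (hs : DifferentiableAt ℝ s u)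
    (hdet : ∀ᶠ w in nhds u, (lam A w - s w • g A w).det = 0) {v : E2}
    (hv : ∀ i, ∑ j, (lam A u i j - s u * g A u i j) * omega A u v 0 (tg j) = 0)
    (hne : lam A u - s u • g A u ≠ 0) :
    trilin (lam3 A u) (fun i => omega A u v 0 (tg i)) (fun i => omega A u v 0 (tg i))
        (fun i => omega A u v 0 (tg i))
      = bilin (g A u) (fun i => omega A u v 0 (tg i)) (fun i => omega A u v 0 (tg i))
        * (fderiv ℝ s u v + s u * omega A u v 0 0 + omega A u v 3 0) := by
  have hsl : lam A u 1 0 = lam A u 0 1 := hA.lam_symm hu 1 0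
  have hsg : g A u 1 0 = g A u 0 1 := g_symm A u 1 0
  have hb : ∀ i j, HasFDerivAt (fun w => lam A w i j - s w * g A w i j) _ u := fun i j =>
    (hA.differentiableAt_lam hu i j).hasFDerivAt.sub
      (hs.hasFDerivAt.mul (hA.differentiableAt_g hu i j).hasFDerivAt)
  have hdet' : (fun w => (lam A w 0 0 - s w * g A w 0 0) * (lam A w 1 1 - s w * g A w 1 1)
      - (lam A w 0 1 - s w * g A w 0 1) * (lam A w 0 1 - s w * g A w 0 1)) =ᶠ[nhds u]
      fun _ => 0 := by
    filter_upwards [hdet, hA.isOpen.mem_nhds hu] with w hw hwU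
    rw [Matrix.det_fin_two] at hw
    simpa [hA.lam_symm hwU 1 0, g_symm A w 1 0] using hw
  -- The equation det(λ - s g) = 0 is differentiated; `hD` is its value on v.
  have hD0 := (((hb 0 0).mul (hb 1 1)).sub ((hb 0 1).mul (hb 0 1))).fderiv.symm.trans
    hdet'.fderiv_eq
  have hD := congrArg (fun L : E2 →L[ℝ] ℝ => L v) hD0
  simp only [_root_.sub_apply, _root_.add_apply, _root_.smul_apply, smul_eq_mul,
    fderiv_fun_const, Pi.zero_apply, _root_.zero_apply] at hD
  have e0 := hv 0
  have e1 := hv 1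
  have G00 := hA.fderiv_g hu 0 0 v
  have G01 := hA.fderiv_g hu 0 1 v
  have G11 := hA.fderiv_g hu 1 1 v
  have L00 := hA.lam3_apply hu 0 0 v
  have L01 := hA.lam3_apply hu 0 1 v
  have L10 := hA.lam3_apply hu 1 0 v
  have L11 := hA.lam3_apply hu 1 1 v
  have hl10 : (fun w => lam A w 1 0) =ᶠ[nhds u] fun w => lam A w 0 1 := by
    filter_upwards [hA.isOpen.mem_nhds hu] with x hx using hA.lam_symm hx 1 0
  rw [hl10.fderiv_eq] at L10
  have hne' : ¬ (lam A u 0 0 - s u * g A u 0 0 = 0 ∧ lam A u 0 1 - s u * g A u 0 1 = 0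
      ∧ lam A u 1 1 - s u * g A u 1 1 = 0) := by
    rintro ⟨h1, h2, h3⟩
    refine hne ?_
    ext i j
    fin_cases i <;> fin_cases j <;> simp [hsl, hsg, h1, h2, h3]
  simp only [Fin.sum_univ_two, hsl, hsg, trilin, bilin] at e0 e1 G00 G01 G11 L00 L01 L10 L11 ⊢
  have key := kernel_of_stationary_det
    (d00 := fderiv ℝ (fun w => lam A w 0 0) u v
      - (s u * fderiv ℝ (fun w => g A w 0 0) u v + g A u 0 0 * fderiv ℝ s u v))
    (d01 := fderiv ℝ (fun w => lam A w 0 1) u v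
      - (s u * fderiv ℝ (fun w => g A w 0 1) u v + g A u 0 1 * fderiv ℝ s u v))
    (d11 := fderiv ℝ (fun w => lam A w 1 1) u v
      - (s u * fderiv ℝ (fun w => g A w 1 1) u v + g A u 1 1 * fderiv ℝ s u v))
    e0 e1 hne' (by linear_combination hD)
  rw [G00, G01, G11] at key
  generalize omega A u v 0 (tg 0) = x at *
  generalize omega A u v 0 (tg 1) = y at *
  -- The connection forms ω_i^k enter only multiplied by components of (λ - s g) v = 0, and for the
  -- same reason λ(v, v) ω_0^0 may be replaced by s g(v, v) ω_0^0.
  linear_combination key + x ^ 2 * L00 + x * y * L01 + x * y * L10 + y ^ 2 * L11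
    - 2 * (omega A u v (tg 0) (tg 0) * x * e0 + omega A u v (tg 0) (tg 1) * x * e1
      + omega A u v (tg 1) (tg 0) * y * e0 + omega A u v (tg 1) (tg 1) * y * e1)
    + omega A u v 0 0 * (x * e0 + y * e1)

end IsFrameOn

/-! ### Traces with respect to a symmetric matrix -/

section Algebra

/-- The trace of a symmetric matrix with respect to a symmetric matrix of order two. -/
lemma sum_inv_mul {G X : Matrix (Fin 2) (Fin 2) ℝ} (hG : G 1 0 = G 0 1) (hX : X 1 0 = X 0 1)
    (hd : G.det ≠ 0) :
    G.det * ∑ i, ∑ j, G⁻¹ i j * X i j = G 1 1 * X 0 0 - 2 * G 0 1 * X 0 1 + G 0 0 * X 1 1 := by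
  simp only [Matrix.inv_def, Matrix.adjugate_fin_two, Ring.inverse_eq_inv', Matrix.smul_apply,
    smul_eq_mul, Fin.sum_univ_two, Matrix.of_apply, Matrix.cons_val_zero, Matrix.cons_val_one,
    Matrix.cons_val', Matrix.empty_val', Matrix.cons_val_fin_one]
  rw [hX, hG]
  field_simp
  ring

/-- The trace of a symmetric matrix in an orthogonal basis. -/
lemma sum_inv_mul_of_orthogonal {G X : Matrix (Fin 2) (Fin 2) ℝ} (hG : G 1 0 = G 0 1)
    (hX : X 1 0 = X 0 1) (hd : G.det ≠ 0) {x y : Fin 2 → ℝ} (hxy : bilin G x y = 0) :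
    bilin G x x * bilin G y y * ∑ i, ∑ j, G⁻¹ i j * X i j
      = bilin G y y * bilin X x x + bilin G x x * bilin X y y := by
  have h := sum_inv_mul hG hX hd
  -- Gram's identity G(x,x) G(y,y) - G(x,y)² = det G · (x_0 y_1 - x_1 y_0)².
  have h1 : bilin G x x * bilin G y y = G.det * (x 0 * y 1 - x 1 * y 0) ^ 2 := by
    rw [Matrix.det_fin_two]
    simp only [bilin, Fin.sum_univ_two, hG] at hxy ⊢
    linear_combination (G 0 0 * x 0 * y 0 + G 0 1 * x 0 * y 1 + G 0 1 * x 1 * y 0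
      + G 1 1 * x 1 * y 1) * hxy
  rw [h1]
  simp only [bilin, Fin.sum_univ_two, hG, hX] at hxy h ⊢
  linear_combination (x 0 * y 1 - x 1 * y 0) ^ 2 * h
    - 2 * (X 0 0 * x 0 * y 0 + X 0 1 * x 0 * y 1 + X 0 1 * x 1 * y 0 + X 1 1 * x 1 * y 1) * hxy

end Algebra

/-! ### The tensors a_{ij} and a_{ijk} on principal vectors -/

namespace IsFrameOn

variable {U : Set E2} {A : Fin 5 → E2 → Poly} (hA : IsFrameOn U A) {u : E2} (hu : u ∈ U)
include hA hu

lemma a2_symm (i j : Fin 2) : a2 A u i j = a2 A u j i := by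
  rw [a2_apply, a2_apply, hA.lam_symm hu, g_symm]

/-- The left side is det g times the g-trace of a, which subtracting the mean curvature makes zero.
-/
lemma trace_a2 :
    g A u 1 1 * a2 A u 0 0 - 2 * g A u 0 1 * a2 A u 0 1 + g A u 0 0 * a2 A u 1 1 = 0 := by
  have h := sum_inv_mul (g_symm A u 1 0) (hA.lam_symm hu 1 0) (hA.g_det_pos hu).ne'
  have hm : meanLam A u = (1 / 2 : ℝ) * ∑ i, ∑ j, (g A u)⁻¹ i j * lam A u i j := rfl
  simp only [a2_apply]
  rw [Matrix.det_fin_two, g_symm A u 1 0] at h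
  linear_combination - h - 2 * (g A u 0 0 * g A u 1 1 - g A u 0 1 * g A u 0 1) * hm

/-- The term linear in s is the trace of a. Its absence is why the two eigenvalues of a are
opposite. -/
lemma det_a2_sub (s : ℝ) : (a2 A u - s • g A u).det = (a2 A u).det + s ^ 2 * (g A u).det := by
  have h := hA.trace_a2 hu
  simp only [Matrix.det_fin_two, Matrix.sub_apply, Matrix.smul_apply, smul_eq_mul]
  rw [hA.a2_symm hu 1 0, g_symm A u 1 0]
  linear_combination - s * h

/-- A trace-free form is not definite. This makes the radicand of `halfGap` nonnegative, so that
principal curvatures exist. -/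
lemma det_a2_nonpos : (a2 A u).det ≤ 0 := by
  have h := hA.trace_a2 hu
  have hd := hA.g_det_pos' hu
  have h0 := hA.g_zero_zero_pos hu
  rw [Matrix.det_fin_two, hA.a2_symm hu 1 0]
  have key : g A u 0 0 ^ 2 * (a2 A u 0 0 * a2 A u 1 1 - a2 A u 0 1 * a2 A u 0 1)
      = - (g A u 0 0 * a2 A u 0 1 - g A u 0 1 * a2 A u 0 0) ^ 2
        - (g A u 0 0 * g A u 1 1 - g A u 0 1 * g A u 0 1) * a2 A u 0 0 ^ 2 := by
    linear_combination g A u 0 0 * a2 A u 0 0 * h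
  by_contra hc
  have h1 := mul_pos (pow_pos h0 2) (not_le.1 hc)
  have h2 := mul_nonneg hd.le (sq_nonneg (a2 A u 0 0))
  have h3 := sq_nonneg (g A u 0 0 * a2 A u 0 1 - g A u 0 1 * a2 A u 0 0)
  linarith

lemma bilin_g_pos {x : Fin 2 → ℝ} (hx : x ≠ 0) : 0 < bilin (g A u) x x := by
  have hd := hA.g_det_pos' hu
  have h0 := hA.g_zero_zero_pos hu
  have h : g A u 0 0 * bilin (g A u) x x = (g A u 0 0 * x 0 + g A u 0 1 * x 1) ^ 2
      + (g A u 0 0 * g A u 1 1 - g A u 0 1 * g A u 0 1) * x 1 ^ 2 := by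
    simp only [bilin, Fin.sum_univ_two, g_symm A u 1 0]; ring
  refine (mul_pos_iff_of_pos_left h0).1 ?_
  rw [h]
  by_cases h1 : x 1 = 0
  · have h2 : x 0 ≠ 0 := fun h2 => hx (by funext i; fin_cases i <;> simpa)
    rw [h1]
    have := mul_ne_zero h0.ne' h2
    rw [mul_zero, add_zero, zero_pow two_ne_zero, mul_zero, add_zero]
    positivity
  · exact add_pos_of_nonneg_of_pos (sq_nonneg _) (mul_pos hd (by positivity))

omit hA hu in
-- The definition of μ solved for the trace of λ_{ijk}; only this form, without the inverse of a, is
-- used later.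
lemma _root_.ConformalSurface.a2_mulVec_mu (hd : (a2 A u).det ≠ 0) (k : Fin 2) :
    ∑ l, a2 A u k l * mu A u l = (1 / 2 : ℝ) * ∑ i, ∑ j, (g A u)⁻¹ i j * lam3 A u i j k := by
  have h1 : mu A u = (a2 A u)⁻¹ *ᵥ fun k =>
      (1 / 2 : ℝ) * ∑ i, ∑ j, (g A u)⁻¹ i j * lam3 A u i j k := rfl
  have h2 : a2 A u *ᵥ mu A u
      = fun k => (1 / 2 : ℝ) * ∑ i, ∑ j, (g A u)⁻¹ i j * lam3 A u i j k := by
    rw [h1, Matrix.mulVec_mulVec, Matrix.mul_nonsing_inv _ hd.isUnit, Matrix.one_mulVec]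
  exact congrFun h2 k

/-- λ_{ijk} is totally symmetric by the Codazzi equations, and the correction is a cyclic sum built
from symmetric matrices. -/
lemma a3_symm_left (i j k : Fin 2) : a3 A u i j k = a3 A u j i k := by
  simp only [a3, hA.lam3_symm_left hu i j, hA.a2_symm hu i j, g_symm A u i j]
  congr 1
  refine Finset.sum_congr rfl fun l _ => ?_
  rw [hA.a2_symm hu k i, hA.a2_symm hu j k, g_symm A u k i, g_symm A u j k]
  ring

lemma a3_symm_right (i j k : Fin 2) : a3 A u i j k = a3 A u i k j := by
  simp only [a3, hA.lam3_symm_right hu i j]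
  congr 1
  refine Finset.sum_congr rfl fun l _ => ?_
  rw [hA.a2_symm hu k i, hA.a2_symm hu j k, g_symm A u k i, g_symm A u j k, hA.a2_symm hu j i,
    g_symm A u j i]
  ring

/-- `a_{ijk}` and `λ_{ijk}` agree on principal vectors. -/
lemma trilin_a3_self {x : Fin 2 → ℝ} {s : ℝ}
    (hx : ∀ i, ∑ j, a2 A u i j * x j = s * ∑ j, g A u i j * x j) :
    trilin (a3 A u) x x x = trilin (lam3 A u) x x x := by
  have e0 := hx 0
  have e1 := hx 1
  simp only [Fin.sum_univ_two, trilin, a3, hA.a2_symm hu 1 0, g_symm A u 1 0] at e0 e1 ⊢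
  set m := mu A u
  -- The correction on (x,x,x) is 3 (a(x,x) g(x,μ) - g(x,x) a(x,μ)), which cancels when a x = s g x.
  linear_combination 3 * (g A u 0 0 * x 0 * m 0 + g A u 0 1 * x 0 * m 1 + g A u 0 1 * x 1 * m 0
      + g A u 1 1 * x 1 * m 1) * (x 0 * e0 + x 1 * e1)
    - 3 * (g A u 0 0 * x 0 ^ 2 + 2 * g A u 0 1 * x 0 * x 1 + g A u 1 1 * x 1 ^ 2)
      * (m 0 * e0 + m 1 * e1)

/-- Both s g(x,y) and t g(x,y) equal a(x,y), by the symmetry of a. -/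
lemma bilin_g_eq_zero {x y : Fin 2 → ℝ} {s t : ℝ}
    (hx : ∀ i, ∑ j, a2 A u i j * x j = s * ∑ j, g A u i j * x j)
    (hy : ∀ i, ∑ j, a2 A u i j * y j = t * ∑ j, g A u i j * y j) (hst : s ≠ t) :
    bilin (g A u) x y = 0 := by
  refine (mul_eq_zero.1 (?_ : (s - t) * _ = 0)).resolve_left (sub_ne_zero.2 hst)
  have e0 := hx 0
  have e1 := hx 1
  have f0 := hy 0
  have f1 := hy 1
  simp only [Fin.sum_univ_two, bilin, hA.a2_symm hu 1 0, g_symm A u 1 0] at e0 e1 f0 f1 ⊢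
  linear_combination - y 0 * e0 - y 1 * e1 + x 0 * f0 + x 1 * f1

/-- The reason for the choice of μ. As g(x,y) = a(x,y) = 0, the correction on (x,x,y) is 2 s g(x,x)
g(μ,y). The g-trace of λ(·,·,y) is 2 a(μ,y) = -2 s g(μ,y), and in the orthogonal basis x, y it
equals λ(x,x,y)/g(x,x) when λ(y,y,y) = 0. The two contributions cancel. -/
lemma trilin_a3_mixed (hd : (a2 A u).det ≠ 0) {x y : Fin 2 → ℝ} {s : ℝ} (hs : s ≠ 0)
    (hy0 : y ≠ 0)
    (hx : ∀ i, ∑ j, a2 A u i j * x j = s * ∑ j, g A u i j * x j)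
    (hy : ∀ i, ∑ j, a2 A u i j * y j = -s * ∑ j, g A u i j * y j)
    (hyyy : trilin (lam3 A u) y y y = 0) : trilin (a3 A u) x x y = 0 := by
  have hxy : bilin (g A u) x y = 0 :=
    hA.bilin_g_eq_zero hu hx hy fun h => hs (by linarith)
  have hpy := hA.bilin_g_pos hu hy0
  have htr := sum_inv_mul_of_orthogonal (G := g A u)
    (X := Matrix.of fun i j => ∑ k, lam3 A u i j k * y k) (g_symm A u 1 0)
    (by simp only [Matrix.of_apply, hA.lam3_symm_left hu 1 0]) (hA.g_det_pos hu).ne'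
    hxy
  have hby : bilin (Matrix.of fun i j => ∑ k, lam3 A u i j k * y k) y y
      = trilin (lam3 A u) y y y := by
    simp only [bilin, trilin, Fin.sum_univ_two, Matrix.of_apply]; ring
  have hbx : bilin (Matrix.of fun i j => ∑ k, lam3 A u i j k * y k) x x
      = trilin (lam3 A u) x x y := by
    simp only [bilin, trilin, Fin.sum_univ_two, Matrix.of_apply]; ring
  rw [hby, hbx, hyyy, mul_zero, add_zero] at htr
  have htr' : bilin (g A u) x x * ∑ i, ∑ j, (g A u)⁻¹ i j * ∑ k, lam3 A u i j k * y k
      = trilin (lam3 A u) x x y := by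
    refine mul_left_cancel₀ hpy.ne' ?_
    rw [← htr]
    simp only [Matrix.of_apply]; ring
  have m0 := a2_mulVec_mu hd 0
  have m1 := a2_mulVec_mu hd 1
  have e0 := hx 0
  have e1 := hx 1
  have f0 := hy 0
  have f1 := hy 1
  have key : trilin (a3 A u) x x y = trilin (lam3 A u) x x y + 2 * s * bilin (g A u) x x
      * bilin (g A u) (mu A u) y := by
    simp only [Fin.sum_univ_two, bilin, trilin, a3, hA.a2_symm hu 1 0, g_symm A u 1 0]
      at hxy e0 e1 f0 f1 ⊢
    set m := mu A u
    linear_combination (2 * (g A u 0 0 * x 0 * m 0 + g A u 0 1 * x 0 * m 1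
        + g A u 0 1 * x 1 * m 0 + g A u 1 1 * x 1 * m 1)) * (y 0 * e0 + y 1 * e1)
      + (g A u 0 0 * y 0 * m 0 + g A u 0 1 * y 0 * m 1 + g A u 0 1 * y 1 * m 0
        + g A u 1 1 * y 1 * m 1) * (x 0 * e0 + x 1 * e1)
      - (g A u 0 0 * x 0 ^ 2 + 2 * g A u 0 1 * x 0 * x 1 + g A u 1 1 * x 1 ^ 2)
        * (m 0 * f0 + m 1 * f1)
      + (2 * s * (g A u 0 0 * x 0 * m 0 + g A u 0 1 * x 0 * m 1 + g A u 0 1 * x 1 * m 0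
        + g A u 1 1 * x 1 * m 1) - 2 * (a2 A u 0 0 * x 0 * m 0 + a2 A u 0 1 * x 0 * m 1
        + a2 A u 0 1 * x 1 * m 0 + a2 A u 1 1 * x 1 * m 1)) * hxy
  rw [key, ← htr']
  simp only [Fin.sum_univ_two, bilin, hA.a2_symm hu 1 0, g_symm A u 1 0] at f0 f1 m0 m1 ⊢
  set m := mu A u
  linear_combination (g A u 0 0 * x 0 * x 0 + g A u 0 1 * x 0 * x 1 +
      (g A u 0 1 * x 1 * x 0 + g A u 1 1 * x 1 * x 1)) *
    (2 * (m 0 * f0 + m 1 * f1) - 2 * (y 0 * m0 + y 1 * m1))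

/-- In the absence of umbilics, `a_{ijk}` vanishes if `λ_{ijk}` vanishes on the two principal
vectors. -/
lemma a3_eq_zero (hd : (a2 A u).det ≠ 0) {x y : Fin 2 → ℝ} {s : ℝ} (hs : s ≠ 0)
    (hx0 : x ≠ 0) (hy0 : y ≠ 0)
    (hx : ∀ i, ∑ j, a2 A u i j * x j = s * ∑ j, g A u i j * x j)
    (hy : ∀ i, ∑ j, a2 A u i j * y j = -s * ∑ j, g A u i j * y j)
    (hxxx : trilin (lam3 A u) x x x = 0) (hyyy : trilin (lam3 A u) y y y = 0) (i j k : Fin 2) :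
    a3 A u i j k = 0 := by
  have hxy : bilin (g A u) x y = 0 :=
    hA.bilin_g_eq_zero hu hx hy fun h => hs (by linarith)
  refine eq_zero_of_trilin (hA.a3_symm_left hu) (hA.a3_symm_right hu) ?_
    ((hA.trilin_a3_self hu hx).trans hxxx)
    (hA.trilin_a3_mixed hu hd hs hy0 hx hy hyyy)
    (hA.trilin_a3_mixed hu hd (neg_ne_zero.2 hs) hx0 hy (by simpa using hx) hxxx)
    ((hA.trilin_a3_self hu hy).trans hyyy) i j k
  -- Independence of x and y: they are g-orthogonal and nonzero, so their Gram determinant is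
  -- positive.
  intro hD
  have h : bilin (g A u) x x * bilin (g A u) y y = 0 := by
    simp only [bilin, Fin.sum_univ_two, g_symm A u 1 0] at hxy ⊢
    linear_combination (g A u 0 0 * x 0 * y 0 + g A u 0 1 * x 0 * y 1 + g A u 0 1 * x 1 * y 0
      + g A u 1 1 * x 1 * y 1) * hxy + (g A u 0 0 * g A u 1 1 - g A u 0 1 ^ 2)
      * (x 0 * y 1 - x 1 * y 0) * hD
  exact (mul_pos (hA.bilin_g_pos hu hx0) (hA.bilin_g_pos hu hy0)).ne' h

end IsFrameOn

/-! ### Maps of rank one and one-parameter families of spheres -/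

/-- The kernel of a nonzero functional on the plane is a line. -/
lemma exists_smul_eq_of_apply_eq_zero {φ : E2 →L[ℝ] ℝ} (hφ : φ ≠ 0) {v w : E2} (hv : v ≠ 0)
    (h1 : φ v = 0) (h2 : φ w = 0) : ∃ c : ℝ, w = c • v := by
  have hd : ∀ x : E2, x = x 0 • EuclideanSpace.single 0 (1 : ℝ)
      + x 1 • EuclideanSpace.single 1 (1 : ℝ) := fun x => by
    ext i; fin_cases i <;> simp
  have hφx : ∀ x : E2, φ x = x 0 * φ (EuclideanSpace.single 0 1)
      + x 1 * φ (EuclideanSpace.single 1 1) := fun x => by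
    conv_lhs => rw [hd x]
    simp
  rw [hφx] at h1 h2
  set a := φ (EuclideanSpace.single 0 1)
  set b := φ (EuclideanSpace.single 1 1)
  have hD : v 0 * w 1 - v 1 * w 0 = 0 := by
    by_contra hD
    refine hφ (ContinuousLinearMap.ext fun x => ?_)
    have ha : a = 0 := (mul_eq_zero.1
      (by linear_combination w 1 * h1 - v 1 * h2 : (v 0 * w 1 - v 1 * w 0) * a = 0)).resolve_left hD
    have hb : b = 0 := (mul_eq_zero.1
      (by linear_combination v 0 * h2 - w 0 * h1 : (v 0 * w 1 - v 1 * w 0) * b = 0)).resolve_left hD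
    rw [hφx, ha, hb]; simp
  by_cases h0 : v 0 = 0
  · have h1 : v 1 ≠ 0 := fun h1 => hv (by ext i; fin_cases i <;> simpa)
    refine ⟨w 1 / v 1, ?_⟩
    have hw : w 0 = 0 := (mul_eq_zero.1
      (by linear_combination -hD + w 1 * h0 : v 1 * w 0 = 0)).resolve_left h1
    ext i
    fin_cases i
    · simp [h0, hw]
    · simp [h1]
  · refine ⟨w 0 / v 0, ?_⟩
    ext i
    fin_cases i
    · simp [h0]
    · simp only [Fin.mk_one, PiLp.smul_apply, smul_eq_mul]
      field_simp
      linear_combination hD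

section Rank

variable {F : Type*} [NormedAddCommGroup F] [NormedSpace ℝ F]

/-- A smooth map of rank one on the plane factors locally through a submersion to the line. -/
lemma exists_factor_of_rank_one {U : Set E2} (hU : IsOpen U) {S : E2 → F}
    (hS : ContDiffOn ℝ ∞ S U) (hker : ∀ u ∈ U, ∃ v ≠ 0, fderiv ℝ S u v = 0) {u₀ : E2}
    (hu₀ : u₀ ∈ U) (hne : fderiv ℝ S u₀ ≠ 0) :
    ∃ N ⊆ U, IsOpen N ∧ u₀ ∈ N ∧ ∃ t : E2 → ℝ, ContDiffOn ℝ ∞ t N ∧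
      (∀ u ∈ N, fderiv ℝ t u ≠ 0) ∧ IsOpen (t '' N) ∧
      (∀ u ∈ N, ∀ v, fderiv ℝ S u v = 0 → fderiv ℝ t u v = 0) ∧
      ∃ R : ℝ → F, ContDiffOn ℝ ∞ R (t '' N) ∧ ∀ u ∈ N, S u = R (t u) := by
  obtain ⟨w₀, hw₀⟩ : ∃ w, fderiv ℝ S u₀ w ≠ 0 := by
    by_contra! h
    exact hne (ContinuousLinearMap.ext h)
  -- Local coordinates (ℓ ∘ S, y): ℓ detects the image of dS at the base point, and the linear
  -- function y detects its kernel.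
  obtain ⟨ℓ, hℓ⟩ := SeparatingDual.exists_ne_zero (R := ℝ) hw₀
  obtain ⟨v₀, hv₀, hSv₀⟩ := hker u₀ hu₀
  obtain ⟨y, hy⟩ := SeparatingDual.exists_ne_zero (R := ℝ) hv₀
  have hdS : ∀ u ∈ U, HasFDerivAt S (fderiv ℝ S u) u := fun u hu =>
    ((hS.differentiableOn (by simp)).differentiableAt (hU.mem_nhds hu)).hasFDerivAt
  set D : E2 → E2 →L[ℝ] ℝ × ℝ := fun u => (ℓ.comp (fderiv ℝ S u)).prod y with hD
  set Φ : E2 → ℝ × ℝ := fun u => (ℓ (S u), y u) with hΦ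
  have hΦd : ∀ u ∈ U, HasFDerivAt Φ (D u) u := fun u hu =>
    (ℓ.hasFDerivAt.comp u (hdS u hu)).prodMk y.hasFDerivAt
  have hΦs : ContDiffOn ℝ ∞ Φ U := (ℓ.contDiff.comp_contDiffOn hS).prodMk y.contDiff.contDiffOn
  have hℓ0 : ℓ.comp (fderiv ℝ S u₀) ≠ 0 := fun h => hℓ (congrArg (fun L : E2 →L[ℝ] ℝ => L w₀) h)
  have hinj : Function.Injective (D u₀) := by
    rw [injective_iff_map_eq_zero]
    intro w hw
    have h1 : ℓ (fderiv ℝ S u₀ w) = 0 := congrArg Prod.fst hw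
    have h2 : y w = 0 := congrArg Prod.snd hw
    obtain ⟨c, rfl⟩ := exists_smul_eq_of_apply_eq_zero (w := w) hℓ0 hv₀ (by simp [hSv₀]) h1
    rw [map_smul, smul_eq_mul] at h2
    rw [(mul_eq_zero.1 h2).resolve_right hy, zero_smul]
  let e₀ : E2 ≃L[ℝ] ℝ × ℝ :=
    (LinearMap.linearEquivOfInjective (D u₀ : E2 →ₗ[ℝ] ℝ × ℝ) hinj (by simp)).toContinuousLinearEquiv
  have he₀ : (e₀ : E2 →L[ℝ] ℝ × ℝ) = D u₀ := by ext1 x; rfl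
  have hDc : ContinuousOn D U :=
    (hΦs.fderiv_of_isOpen (m := ∞) hU (by simp)).continuousOn.congr
      fun u hu => (hΦd u hu).fderiv.symm
  -- The inverse function theorem is restricted to points where the derivative remains invertible,
  -- so that ℓ ∘ dS ≠ 0 on all of V.
  set V := U ∩ D ⁻¹' Set.range ((↑) : (E2 ≃L[ℝ] ℝ × ℝ) → E2 →L[ℝ] ℝ × ℝ) with hV
  have hVo : IsOpen V := hDc.isOpen_inter_preimage hU ContinuousLinearEquiv.isOpen
  have hΦ₀ : ContDiffAt ℝ ∞ Φ u₀ := hΦs.contDiffAt (hU.mem_nhds hu₀)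
  have hΦ₀d : HasFDerivAt Φ (e₀ : E2 →L[ℝ] ℝ × ℝ) u₀ := by rw [he₀]; exact hΦd u₀ hu₀
  set H := (hΦ₀.toOpenPartialHomeomorph Φ hΦ₀d (by simp)).restrOpen V hVo with hH
  have hHc : ∀ u, H u = Φ u := fun u => rfl
  have hHV : H.source ⊆ V := fun u hu => hu.2
  have hH₀ : u₀ ∈ H.source :=
    ⟨hΦ₀.mem_toOpenPartialHomeomorph_source hΦ₀d (by simp), hu₀, e₀, he₀⟩
  obtain ⟨ε, hε, hball⟩ := Metric.isOpen_iff.1 H.open_target (Φ u₀) (H.map_source hH₀)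
  -- A product box I × J in the target: each fibre {τ} × J is connected.
  rw [hΦ, ← ball_prod_same] at hball
  set I := Metric.ball (ℓ (S u₀)) ε
  set J := Metric.ball (y u₀) ε
  have hJ₀ : y u₀ ∈ J := Metric.mem_ball_self hε
  have hsymm : ∀ p ∈ H.target, ∃ e : E2 ≃L[ℝ] ℝ × ℝ, (e : E2 →L[ℝ] ℝ × ℝ) = D (H.symm p) ∧
      HasFDerivAt H.symm (e.symm : ℝ × ℝ →L[ℝ] E2) p ∧ ContDiffAt ℝ ∞ H.symm p := by
    intro p hp
    have hq := hHV (H.map_target hp)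
    obtain ⟨e, he⟩ := hq.2
    have hd : HasFDerivAt H (e : E2 →L[ℝ] ℝ × ℝ) (H.symm p) := by
      rw [he]; exact hΦd _ hq.1
    exact ⟨e, he, H.hasFDerivAt_symm hp hd,
      H.contDiffAt_symm hp hd (hΦs.contDiffAt (hU.mem_nhds hq.1))⟩
  have hconst : ∀ τ ∈ I, ∀ η ∈ J, S (H.symm (τ, η)) = S (H.symm (τ, y u₀)) := by
    intro τ hτ η hη
    have hder : ∀ η ∈ J, HasDerivAt (fun η => S (H.symm (τ, η))) 0 η := by
      intro η hη
      have hp : (τ, η) ∈ H.target := hball ⟨hτ, hη⟩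
      obtain ⟨e, he, hd, -⟩ := hsymm _ hp
      have hq := hHV (H.map_target hp)
      set q := H.symm (τ, η)
      have h1 : HasDerivAt (fun η : ℝ => (τ, η)) ((0 : ℝ), (1 : ℝ)) η :=
        (hasDerivAt_const η τ).prodMk (hasDerivAt_id η)
      have h2 : HasDerivAt (fun η => S (H.symm (τ, η))) (fderiv ℝ S q (e.symm (0, 1))) η :=
        (hdS q hq.1).comp_hasDerivAt η (hd.comp_hasDerivAt η h1)
      obtain ⟨v, hv, hSv⟩ := hker q hq.1
      have h3 : D q (e.symm (0, 1)) = (0, 1) := by rw [← he]; simp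
      have h4 : ℓ.comp (fderiv ℝ S q) ≠ 0 := fun h => by
        have h5 : D q (e.symm (1, 0)) = (1, 0) := by rw [← he]; simp
        have h6 := congrArg Prod.fst h5
        have h7 := congrArg (fun L : E2 →L[ℝ] ℝ => L (e.symm (1, 0))) h
        simp only [hD, ContinuousLinearMap.prod_apply] at h6
        rw [h6] at h7
        simp at h7
      -- The direction of the fibre and the kernel vector of dS both lie in the line ker(ℓ ∘ dS), so
      -- dS kills the fibre direction and S is constant on fibres.
      obtain ⟨c, hc⟩ := exists_smul_eq_of_apply_eq_zero (w := e.symm (0, 1)) h4 hv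
        (by simp [hSv]) (congrArg Prod.fst h3)
      rwa [hc, map_smul, hSv, smul_zero] at h2
    exact Metric.isOpen_ball.is_const_of_deriv_eq_zero (convex_ball _ _).isPreconnected
      (fun η hη => (hder η hη).differentiableAt.differentiableWithinAt)
      (fun η hη => (hder η hη).deriv) hη hJ₀
  have hN : IsOpen (H.source ∩ H ⁻¹' (I ×ˢ J)) :=
    H.isOpen_inter_preimage (Metric.isOpen_ball.prod Metric.isOpen_ball)
  have himage : (fun u => ℓ (S u)) '' (H.source ∩ H ⁻¹' (I ×ˢ J)) = I := by
    ext τ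
    constructor
    · rintro ⟨u, hu, rfl⟩
      exact hu.2.1
    · intro hτ
      have hp : (τ, y u₀) ∈ H.target := hball ⟨hτ, hJ₀⟩
      refine ⟨H.symm (τ, y u₀), ⟨H.map_target hp, ?_⟩, ?_⟩
      · rw [Set.mem_preimage, H.right_inv hp]; exact ⟨hτ, hJ₀⟩
      · exact congrArg Prod.fst (H.right_inv hp)
  have hdt : ∀ u ∈ U, fderiv ℝ (fun u => ℓ (S u)) u = ℓ.comp (fderiv ℝ S u) := fun u hu =>
    (ℓ.hasFDerivAt.comp u (hdS u hu)).fderiv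
  refine ⟨H.source ∩ H ⁻¹' (I ×ˢ J), fun u hu => (hHV hu.1).1, hN,
    ⟨hH₀, Metric.mem_ball_self hε, hJ₀⟩, fun u => ℓ (S u),
    (ℓ.contDiff.comp_contDiffOn hS).mono fun u hu => (hHV hu.1).1, fun u hu h => ?_, ?_,
    fun u hu v hv => ?_, fun τ => S (H.symm (τ, y u₀)), ?_, fun u hu => ?_⟩
  · obtain ⟨hu1, e, he⟩ := hHV hu.1
    rw [hdt u hu1] at h
    have h5 : D u (e.symm (1, 0)) = (1, 0) := by rw [← he]; simp
    have h6 := congrArg Prod.fst h5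
    have h7 := congrArg (fun L : E2 →L[ℝ] ℝ => L (e.symm (1, 0))) h
    simp only [hD, ContinuousLinearMap.prod_apply] at h6
    rw [h6] at h7
    simp at h7
  · rw [himage]; exact Metric.isOpen_ball
  · rw [hdt u (hHV hu.1).1, ContinuousLinearMap.comp_apply, hv, map_zero]
  · rw [himage]
    intro τ hτ
    have hp : (τ, y u₀) ∈ H.target := hball ⟨hτ, hJ₀⟩
    obtain ⟨-, -, -, hs⟩ := hsymm _ hp
    have h1 : ContDiffAt ℝ ∞ (fun τ : ℝ => (τ, y u₀)) τ := contDiffAt_id.prodMk contDiffAt_const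
    exact ((hS.contDiffAt (hU.mem_nhds (hHV (H.map_target hp)).1)).comp τ
      (hs.comp τ h1)).contDiffWithinAt
  · have h := hconst _ hu.2.1 _ hu.2.2
    have h2 : H.symm (ℓ (S u), y u) = u := H.left_inv hu.1
    change S (H.symm (ℓ (S u), y u)) = _ at h
    rw [h2] at h
    exact h

/-- A family of spheres of rank one along a surface is a one-parameter family of which the surface
is the envelope. -/
lemma exists_isEnvelope {U : Set E2} (hU : IsOpen U) {S : E2 → F} (hS : ContDiffOn ℝ ∞ S U)
    (hker : ∀ u ∈ U, ∃ v ≠ 0, fderiv ℝ S u v = 0)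
    (hind : ∀ u ∈ U, ∃ w, LinearIndependent ℝ ![S u, fderiv ℝ S u w])
    {isSphere : F → Prop} {touches : F → E2 → Prop} (hsph : ∀ u ∈ U, isSphere (S u))
    (htouch : ∀ u ∈ U, touches (S u) u) {u₀ : E2} (hu₀ : u₀ ∈ U) :
    ∃ N ⊆ U, IsOpen N ∧ u₀ ∈ N ∧ ∃ t : E2 → ℝ, IsEnvelope isSphere touches N t ∧
      ∀ u ∈ N, ∀ v, fderiv ℝ S u v = 0 → fderiv ℝ t u v = 0 := by
  have hne : fderiv ℝ S u₀ ≠ 0 := fun h => by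
    obtain ⟨w, hw⟩ := hind u₀ hu₀
    have := hw.ne_zero 1
    simp [h] at this
  obtain ⟨N, hNU, hN, huN, t, ht, hdt, htN, hv, R, hR, hSR⟩ :=
    exists_factor_of_rank_one hU hS hker hu₀ hne
  refine ⟨N, hNU, hN, huN, t, ⟨ht, hdt, R, hR, ?_, fun u hu => ?_⟩, hv⟩
  · rintro _ ⟨u, hu, rfl⟩
    rw [← hSR u hu]
    refine ⟨hsph u (hNU hu), ?_⟩
    obtain ⟨w, hw⟩ := hind u (hNU hu)
    have h1 : HasFDerivAt t (fderiv ℝ t u) u :=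
      ((ht.differentiableOn (by simp)).differentiableAt (hN.mem_nhds hu)).hasFDerivAt
    have h2 : HasDerivAt R (deriv R (t u)) (t u) :=
      ((hR.differentiableOn (by simp)).differentiableAt
        (htN.mem_nhds ⟨u, hu, rfl⟩)).hasDerivAt
    have h3 : S =ᶠ[nhds u] fun u => R (t u) := by
      filter_upwards [hN.mem_nhds hu] with x hx using hSR x hx
    have h4 : fderiv ℝ S u w = fderiv ℝ t u w • deriv R (t u) := by
      rw [h3.fderiv_eq]
      have := (h2.hasFDerivAt.comp u h1).fderiv
      change fderiv ℝ (fun u => R (t u)) u = _ at this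
      rw [this]
      simp
    -- By the chain rule the derivative of S along w is dt(w) R', and the assumed independence
    -- forces dt(w) ≠ 0.
    rw [h4, LinearIndependent.pair_iff] at hw
    rw [LinearIndependent.pair_iff]
    intro a b hab
    have hc : fderiv ℝ t u w ≠ 0 := fun hc => by
      have := (hw 0 1 (by simp [hc])).2
      simp at this
    have := hw a (b / fderiv ℝ t u w) (by rw [smul_smul, div_mul_cancel₀ _ hc, hab])
    exact ⟨this.1, by simpa [hc] using this.2⟩
  · rw [← hSR u hu]; exact htouch u (hNU hu)

end Rank

lemma exists_ne_zero_apply_eq_zero (φ : E2 →L[ℝ] ℝ) : ∃ v ≠ 0, φ v = 0 := by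
  have h : ¬ Function.Injective (φ : E2 →ₗ[ℝ] ℝ) := fun h => by
    have := LinearMap.finrank_le_finrank_of_injective h
    simp at this
  rw [← LinearMap.ker_eq_bot, Submodule.eq_bot_iff] at h
  push Not at h
  obtain ⟨v, h1, h2⟩ := h
  exact ⟨v, h2, h1⟩

/-- Independent functionals on the plane have no common kernel. -/
lemma eq_zero_of_linearIndependent {φ ψ : E2 →L[ℝ] ℝ} (h : LinearIndependent ℝ ![φ, ψ]) {v : E2}
    (h1 : φ v = 0) (h2 : ψ v = 0) : v = 0 := by
  by_contra hv
  obtain ⟨w, hw⟩ : ∃ w, φ w ≠ 0 := by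
    by_contra! hφ
    exact h.ne_zero 0 (ContinuousLinearMap.ext hφ)
  rw [LinearIndependent.pair_iff] at h
  have hz : ψ w • φ + (-φ w) • ψ = 0 := by
    by_contra hne
    obtain ⟨c, rfl⟩ := exists_smul_eq_of_apply_eq_zero (w := w) hne hv (by simp [h1, h2])
      (by simp; ring)
    simp [h1] at hw
  exact hw (by simpa using (h _ _ hz).2)

/-! ### Tangent spheres and principal directions -/

namespace IsFrameOn

variable {U : Set E2} {A : Fin 5 → E2 → Poly} (hA : IsFrameOn U A) {u : E2} (hu : u ∈ U)
include hA hu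

/-- The covector of Y under the form is (Y_0, Y_1, Y_2, Y_3, -Y_4), and the invertible frame matrix
annihilates it. -/
lemma eq_zero_of_form {Y : Poly} (h : ∀ ξ, form (A ξ u) Y = 0) : Y = 0 := by
  have h1 : (![Y 0, Y 1, Y 2, Y 3, -Y 4] : Fin 5 → ℝ) = 0 := by
    refine Matrix.eq_zero_of_mulVec_eq_zero (hA.isUnit_det hu).ne_zero ?_
    funext ξ
    have := h ξ
    simp only [form] at this
    simp [Matrix.mulVec, dotProduct, Fin.sum_univ_five]
    linarith
  funext k
  have := congrFun h1 k
  fin_cases k <;> simpa using this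

/-- The spheres tangent to the surface are the combinations of `A_3` and `A_0`. -/
lemma eq_of_touch {S : Poly} (h0 : form S (A 0 u) = 0) (ht : ∀ i, form S (A (tg i) u) = 0) :
    S = form S (A 3 u) • A 3 u + (- form S (A 4 u)) • A 0 u := by
  rw [← sub_eq_zero]
  refine hA.eq_zero_of_form hu fun ξ => ?_
  rw [form_comm, sub_eq_add_neg, ← neg_one_smul ℝ (_ + _)]
  simp only [form_add_left, form_smul_left]
  have h1 : form S (A 1 u) = 0 := ht 0
  have h2 : form S (A 2 u) = 0 := ht 1
  fin_cases ξ <;> simp only [Fin.reduceFinMk, Fin.zero_eta, Fin.mk_one, Fin.isValue]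
  · rw [h0, form_comm (A 3 u), hA.zero_three u hu, hA.null_zero u hu]; ring
  · rw [h1, form_comm (A 3 u), hA.one_three hu, hA.zero_one hu]; ring
  · rw [h2, form_comm (A 3 u), hA.two_three hu, hA.zero_two hu]; ring
  · rw [hA.three_three u hu, hA.zero_three u hu]; ring
  · rw [form_comm (A 3 u), hA.four_three u hu, hA.zero_four u hu]; ring

lemma isPrincipal_iff {v : E2} : IsPrincipal A u v ↔ v ≠ 0 ∧ ∃ s : ℝ, ∀ i,
    ∑ j, a2 A u i j * omega A u v 0 (tg j) = s * ∑ j, g A u i j * omega A u v 0 (tg j) := by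
  refine and_congr_right fun _ => exists_congr fun s => ?_
  have hd := (hA.g_det_pos hu).ne'.isUnit
  set x : Fin 2 → ℝ := fun i => omega A u v 0 (tg i)
  have h : ((g A u)⁻¹ * a2 A u) *ᵥ x = s • x ↔ a2 A u *ᵥ x = s • (g A u *ᵥ x) := by
    rw [← Matrix.mulVec_mulVec, ← Matrix.mulVec_smul]
    constructor
    · intro h
      rw [← h, Matrix.mulVec_mulVec, Matrix.mul_nonsing_inv _ hd, Matrix.one_mulVec]
    · intro h
      rw [h, Matrix.mulVec_mulVec, Matrix.nonsing_inv_mul _ hd, Matrix.one_mulVec]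
  rw [h, funext_iff]
  rfl

omit hA hu in
lemma _root_.ConformalSurface.sum_a2_eq_iff (A : Fin 5 → E2 → Poly) (u : E2) (s : ℝ)
    (x : Fin 2 → ℝ) (i : Fin 2) :
    ∑ j, a2 A u i j * x j = (s - meanLam A u) * ∑ j, g A u i j * x j
      ↔ ∑ j, (lam A u i j - s * g A u i j) * x j = 0 := by
  rw [← sub_eq_zero]
  simp only [Fin.sum_univ_two, a2_apply]
  constructor <;> intro h <;> linear_combination h

/-- The principal curvatures are opposite to each other relative to the mean curvature. -/
lemma det_a2_eq {v : E2} (hv : v ≠ 0) {s : ℝ}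
    (h : ∀ i, ∑ j, a2 A u i j * omega A u v 0 (tg j) = s * ∑ j, g A u i j * omega A u v 0 (tg j)) :
    (a2 A u).det + s ^ 2 * (g A u).det = 0 := by
  rw [← hA.det_a2_sub hu, ← Matrix.exists_mulVec_eq_zero_iff]
  refine ⟨fun i => omega A u v 0 (tg i), fun hx => hv (hA.eq_zero_of_omega hu (congrFun hx)), ?_⟩
  funext i
  have := h i
  simp only [Matrix.mulVec, dotProduct, Fin.sum_univ_two, Matrix.sub_apply, Matrix.smul_apply,
    smul_eq_mul, Pi.zero_apply] at this ⊢
  linarith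

lemma ne_zero_of_principal (hd : (a2 A u).det ≠ 0) {v : E2} (hv : v ≠ 0) {s : ℝ}
    (h : ∀ i, ∑ j, a2 A u i j * omega A u v 0 (tg j) = s * ∑ j, g A u i j * omega A u v 0 (tg j)) :
    s ≠ 0 := by
  rintro rfl
  have := hA.det_a2_eq hu hv h
  exact hd (by linarith)

/-- If a = s g, taking traces gives s = 0, hence a = 0, contrary to nondegeneracy. -/
lemma a2_ne_smul_g (hd : (a2 A u).det ≠ 0) (s : ℝ) : a2 A u - s • g A u ≠ 0 := by
  intro h
  have h' : ∀ i j, a2 A u i j = s * g A u i j := fun i j => by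
    have := congrFun (congrFun h i) j
    simp only [Matrix.sub_apply, Matrix.smul_apply, smul_eq_mul, Matrix.zero_apply] at this
    linarith
  have ht := hA.trace_a2 hu
  have hg := hA.g_det_pos' hu
  rw [h', h', h'] at ht
  have hs : s = 0 := (mul_eq_zero.1
    (by linear_combination ht / 2 : s * (g A u 0 0 * g A u 1 1 - g A u 0 1 * g A u 0 1) = 0)).resolve_right
      hg.ne'
  exact hd (by rw [Matrix.det_fin_two, h', h', h', h', hs]; ring)

/-- In the absence of umbilics, a principal direction is determined by its curvature. -/
lemma exists_smul_of_principal (hd : (a2 A u).det ≠ 0) {v w : E2} (hv : v ≠ 0) {s : ℝ}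
    (h1 : ∀ i, ∑ j, a2 A u i j * omega A u v 0 (tg j) = s * ∑ j, g A u i j * omega A u v 0 (tg j))
    (h2 : ∀ i, ∑ j, a2 A u i j * omega A u w 0 (tg j) = s * ∑ j, g A u i j * omega A u w 0 (tg j)) :
    ∃ c : ℝ, w = c • v := by
  let φ (i : Fin 2) : E2 →ₗ[ℝ] ℝ :=
    { toFun := fun v => ∑ j, (a2 A u i j - s * g A u i j) * omega A u v 0 (tg j)
      map_add' := fun v w => by
        simp only [omega_add, Matrix.add_apply, Fin.sum_univ_two]; ring
      map_smul' := fun c v => by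
        simp only [omega_smul, Matrix.smul_apply, Fin.sum_univ_two, smul_eq_mul,
          RingHom.id_apply]; ring }
  have hφ (i : Fin 2) (v : E2) : LinearMap.toContinuousLinearMap (φ i) v
      = ∑ j, (a2 A u i j - s * g A u i j) * omega A u v 0 (tg j) := rfl
  have hker (i : Fin 2) {v : E2} (h : ∀ i, ∑ j, a2 A u i j * omega A u v 0 (tg j)
      = s * ∑ j, g A u i j * omega A u v 0 (tg j)) :
      LinearMap.toContinuousLinearMap (φ i) v = 0 := by
    have := h i
    rw [hφ]
    simp only [Fin.sum_univ_two] at this ⊢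
    linarith
  by_cases h : ∀ i, LinearMap.toContinuousLinearMap (φ i) = 0
  · refine absurd ?_ (hA.a2_ne_smul_g hu hd s)
    ext i j
    have h3 : LinearMap.toContinuousLinearMap (φ i) (dual A u j) = 0 := by rw [h i]; rfl
    rw [hφ] at h3
    simpa [hA.omega_dual hu] using h3
  · push Not at h
    obtain ⟨i, hi⟩ := h
    exact exists_smul_eq_of_apply_eq_zero hi hv (hker i h1) (hker i h2)

/-- The derivative of a sphere tangent to the surface. -/
lemma fderiv_sphere {s : E2 → ℝ} (hs : DifferentiableAt ℝ s u) (v : E2) :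
    fderiv ℝ (fun x => A 3 x + s x • A 0 x) u v
      = ∑ η, (![omega A u v 3 0 + s u * omega A u v 0 0 + fderiv ℝ s u v,
          omega A u v 3 1 + s u * omega A u v 0 1, omega A u v 3 2 + s u * omega A u v 0 2, 0, 0] :
          Fin 5 → ℝ) η • A η u := by
  have hn := hA.isOpen.mem_nhds hu
  have h3 := ((hA.differentiableOn 3).differentiableAt hn).hasFDerivAt
  have h0 := ((hA.differentiableOn 0).differentiableAt hn).hasFDerivAt
  have h : fderiv ℝ (fun x => A 3 x + s x • A 0 x) u = _ :=
    (h3.add (hs.hasFDerivAt.smul h0)).fderiv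
  rw [h]
  simp only [_root_.add_apply, _root_.smul_apply, ContinuousLinearMap.smulRight_apply]
  rw [hA.fderiv_eq hu, hA.fderiv_eq hu]
  simp only [Fin.sum_univ_five, hA.omega_zero_three hu, hA.omega_zero_four hu,
    hA.omega_three_three hu, hA.omega_three_four hu, smul_add, smul_smul]
  simp [add_smul]
  abel

/-- Rodrigues' formula: λ_{ij} ω^j = ω_i^3 = -g_{ij} ω_3^j, so (λ - s g) v is -g applied to the
tangential part ω_3^j + s ω^j of the derivative of the sphere. -/
lemma omega_three_tg_iff (s : ℝ) (v : E2) :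
    (∀ i, ∑ j, (lam A u i j - s * g A u i j) * omega A u v 0 (tg j) = 0)
      ↔ omega A u v 3 1 + s * omega A u v 0 1 = 0 ∧ omega A u v 3 2 + s * omega A u v 0 2 = 0 := by
  have h (i : Fin 2) := (hA.omega_tg_three hu i v).symm.trans (hA.omega_tg_three_eq hu i v)
  have hg := hA.g_det_pos' hu
  have h0 := h 0
  have h1 := h 1
  simp only [Fin.sum_univ_two, tg, Matrix.cons_val_zero, Matrix.cons_val_one, g_symm A u 1 0]
    at h0 h1
  constructor
  · intro hv
    have e0 := hv 0
    have e1 := hv 1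
    simp only [Fin.sum_univ_two, tg, Matrix.cons_val_zero, Matrix.cons_val_one, g_symm A u 1 0]
      at e0 e1
    constructor
    · refine (mul_eq_zero.1 (?_ : (g A u 0 0 * g A u 1 1 - g A u 0 1 * g A u 0 1) * _ = 0)).resolve_left
        hg.ne'
      linear_combination - g A u 1 1 * (e0 + h0) + g A u 0 1 * (e1 + h1)
    · refine (mul_eq_zero.1 (?_ : (g A u 0 0 * g A u 1 1 - g A u 0 1 * g A u 0 1) * _ = 0)).resolve_left
        hg.ne'
      linear_combination - g A u 0 0 * (e1 + h1) + g A u 0 1 * (e0 + h0)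
  · rintro ⟨e1, e2⟩ i
    fin_cases i <;> simp only [Fin.sum_univ_two, tg, Matrix.cons_val_zero, Matrix.cons_val_one,
      g_symm A u 1 0, Fin.zero_eta, Fin.mk_one]
    · linear_combination - h0 - g A u 0 0 * e1 - g A u 0 1 * e2
    · linear_combination - h1 - g A u 0 1 * e1 - g A u 1 1 * e2

/-- A tangent sphere `A_3 + s A_0` is stationary along `v` if and only if `v` is principal with
principal curvature `s`, and the sphere is stationary to second order. -/
lemma fderiv_sphere_eq_zero_iff {s : E2 → ℝ} (hs : DifferentiableAt ℝ s u) (v : E2) :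
    fderiv ℝ (fun x => A 3 x + s x • A 0 x) u v = 0
      ↔ (∀ i, ∑ j, (lam A u i j - s u * g A u i j) * omega A u v 0 (tg j) = 0)
        ∧ fderiv ℝ s u v + s u * omega A u v 0 0 + omega A u v 3 0 = 0 := by
  rw [hA.fderiv_sphere hu hs, hA.omega_three_tg_iff hu]
  constructor
  · intro h
    have h := hA.combination_eq_zero hu h
    have h0 := congrFun h 0
    have h1 := congrFun h 1
    have h2 := congrFun h 2
    simp only [Matrix.cons_val, Pi.zero_apply] at h0 h1 h2
    exact ⟨⟨h1, h2⟩, by linarith⟩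
  · rintro ⟨⟨h1, h2⟩, h0⟩
    have h0' : omega A u v 3 0 + s u * omega A u v 0 0 + fderiv ℝ s u v = 0 := by linarith
    rw [h0', h1, h2]
    simp [Fin.sum_univ_five]

end IsFrameOn

/-! ### From envelopes to lines of curvature -/

/-- A submersion to the line is open. -/
lemma isOpen_image_of_submersion {N : Set E2} (hN : IsOpen N) {t : E2 → ℝ}
    (ht : ContDiffOn ℝ ∞ t N) (hdt : ∀ u ∈ N, fderiv ℝ t u ≠ 0) : IsOpen (t '' N) := by
  rw [isOpen_iff_mem_nhds]
  rintro _ ⟨u, hu, rfl⟩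
  have h1 : HasStrictFDerivAt t (fderiv ℝ t u) u :=
    (ht.contDiffAt (hN.mem_nhds hu)).hasStrictFDerivAt (by simp)
  have h2 : (fderiv ℝ t u).range = ⊤ := by
    rw [LinearMap.range_eq_top]
    refine LinearMap.surjective fun h => hdt u hu ?_
    ext1 x
    exact congrArg (fun L : E2 →ₗ[ℝ] ℝ => L x) h
  rw [← h1.map_nhds_eq_of_surj h2]
  exact Filter.image_mem_map (hN.mem_nhds hu)

namespace IsFrameOn

variable {U : Set E2} {A : Fin 5 → E2 → Poly} (hA : IsFrameOn U A)
include hA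

/-- The characteristics of an enveloped family of spheres are lines of curvature, on which the form
`λ_{ijk}` vanishes. -/
lemma principal_of_isEnvelope (hd : ∀ u ∈ U, (a2 A u).det ≠ 0) {N : Set E2} (hNU : N ⊆ U)
    (hN : IsOpen N) {touches : Poly → E2 → Prop}
    (htouch : ∀ u ∈ N, ∀ S, touches S u → form S (A 0 u) = 0 ∧ ∀ i, form S (A (tg i) u) = 0)
    {t : E2 → ℝ} (h : IsEnvelope IsSphere touches N t) {u : E2} (hu : u ∈ N) {v : E2}
    (hv : fderiv ℝ t u v = 0) :
    ∃ s : ℝ, (∀ i, ∑ j, a2 A u i j * omega A u v 0 (tg j)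
        = s * ∑ j, g A u i j * omega A u v 0 (tg j)) ∧
      trilin (lam3 A u) (fun i => omega A u v 0 (tg i)) (fun i => omega A u v 0 (tg i))
        (fun i => omega A u v 0 (tg i)) = 0 := by
  obtain ⟨ht, hdt, R, hR, hRs, htou⟩ := h
  have hopen := isOpen_image_of_submersion hN ht hdt
  have hPs : ContDiffOn ℝ ∞ (fun x => R (t x)) N := hR.comp ht (Set.mapsTo_image t N)
  have hPd : ∀ x ∈ N, DifferentiableAt ℝ (fun x => R (t x)) x := fun x hx =>
    (hPs.differentiableOn (by simp)).differentiableAt (hN.mem_nhds hx)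
  have hP0 : ∀ x ∈ N, ∀ v, fderiv ℝ t x v = 0 → fderiv ℝ (fun x => R (t x)) x v = 0 := by
    intro x hx v hv
    have h1 : HasFDerivAt t (fderiv ℝ t x) x :=
      ((ht.differentiableOn (by simp)).differentiableAt (hN.mem_nhds hx)).hasFDerivAt
    have h2 : HasFDerivAt R (fderiv ℝ R (t x)) (t x) :=
      ((hR.differentiableOn (by simp)).differentiableAt (hopen.mem_nhds ⟨x, hx, rfl⟩)).hasFDerivAt
    have h3 : fderiv ℝ (fun x => R (t x)) x = _ := (h2.comp x h1).fderiv
    rw [h3, ContinuousLinearMap.comp_apply, hv, map_zero]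
  set ρ : E2 → ℝ := fun x => form (R (t x)) (A 3 x) with hρ
  set σ : E2 → ℝ := fun x => - form (R (t x)) (A 4 x) with hσ
  have hPeq : ∀ x ∈ N, R (t x) = ρ x • A 3 x + σ x • A 0 x := fun x hx => by
    obtain ⟨h1, h2⟩ := htouch x hx _ (htou x hx)
    exact hA.eq_of_touch (hNU hx) h1 h2
  -- Without an `A_3` component the vector would be a multiple of the null vector `A_0`, not a
  -- sphere.
  have hρ0 : ∀ x ∈ N, ρ x ≠ 0 := fun x hx h0 => by
    have h1 : 0 < form (R (t x)) (R (t x)) := (hRs _ ⟨x, hx, rfl⟩).1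
    rw [hPeq x hx, h0, zero_smul, zero_add, form_smul_left, form_smul_right,
      hA.null_zero x (hNU hx)] at h1
    simp at h1
  have hρs : ContDiffOn ℝ ∞ ρ N := hPs.form ((hA.smooth 3).mono hNU)
  have hσs : ContDiffOn ℝ ∞ σ N := (hPs.form ((hA.smooth 4).mono hNU)).neg
  have hss : ContDiffOn ℝ ∞ (fun x => σ x / ρ x) N := hσs.div hρs hρ0
  have hsd : ∀ x ∈ N, DifferentiableAt ℝ (fun x => σ x / ρ x) x := fun x hx =>
    (hss.differentiableOn (by simp)).differentiableAt (hN.mem_nhds hx)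
  have hstat : ∀ x ∈ N, ∀ v, fderiv ℝ t x v = 0 →
      fderiv ℝ (fun x => A 3 x + (σ x / ρ x) • A 0 x) x v = 0 := by
    intro x hx v hv
    have h1 : (fun x => A 3 x + (σ x / ρ x) • A 0 x) =ᶠ[nhds x] fun x => (ρ x)⁻¹ • R (t x) := by
      filter_upwards [hN.mem_nhds hx] with y hy
      rw [hPeq y hy, smul_add, smul_smul, smul_smul, inv_mul_cancel₀ (hρ0 y hy), one_smul,
        div_eq_inv_mul]
    have hi : DifferentiableAt ℝ (fun x => (ρ x)⁻¹) x :=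
      (((hρs.differentiableOn (by simp)).differentiableAt (hN.mem_nhds hx)).inv (hρ0 x hx))
    have h2 : fderiv ℝ (fun x => (ρ x)⁻¹ • R (t x)) x = _ :=
      (hi.hasFDerivAt.smul (hPd x hx).hasFDerivAt).fderiv
    have h3 := hA.fderiv_sphere (hNU hx) (hsd x hx) v
    rw [h1.fderiv_eq, h2] at h3
    simp only [_root_.add_apply, _root_.smul_apply, ContinuousLinearMap.smulRight_apply,
      hP0 x hx v hv, smul_zero, zero_add] at h3
    -- R ∘ t is stationary along the characteristic, but only up to scale does it equal `A_3 + s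
    -- A_0`; κ is the derivative of the scale factor. Comparing `A_3` components gives κ ρ = 0,
    -- because the normalized sphere has constant `A_3` component.
    set κ := fderiv ℝ (fun x => (ρ x)⁻¹) x v
    have h4 : κ • R (t x) = ∑ η, (![κ * σ x, 0, 0, κ * ρ x, 0] : Fin 5 → ℝ) η • A η x := by
      rw [hPeq x hx, smul_add, smul_smul, smul_smul]
      simp [Fin.sum_univ_five, add_comm]
    have h5 := congrFun (hA.combination_injective (hNU hx) (h4.symm.trans h3)) 3
    simp only [Matrix.cons_val] at h5
    have hκ : κ = 0 := (mul_eq_zero.1 h5).resolve_right (hρ0 x hx)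
    rw [h1.fderiv_eq, h2]
    simp only [_root_.add_apply, _root_.smul_apply, ContinuousLinearMap.smulRight_apply,
      hP0 x hx v hv, smul_zero, zero_add]
    change κ • _ = 0
    rw [hκ, zero_smul]
  have hprin : ∀ x ∈ N, ∀ v, fderiv ℝ t x v = 0 → _ := fun x hx v hv =>
    (hA.fderiv_sphere_eq_zero_iff (hNU hx) (hsd x hx) v).1 (hstat x hx v hv)
  -- At each nearby point the characteristic direction there is a kernel vector, so the determinant
  -- vanishes on a whole neighbourhood and may be differentiated.
  have hdet : ∀ᶠ w in nhds u, (lam A w - (σ w / ρ w) • g A w).det = 0 := by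
    filter_upwards [hN.mem_nhds hu] with x hx
    obtain ⟨v, hv0, hv⟩ := exists_ne_zero_apply_eq_zero (fderiv ℝ t x)
    refine Matrix.exists_mulVec_eq_zero_iff.1 ⟨fun i => omega A x v 0 (tg i),
      fun h => hv0 (hA.eq_zero_of_omega (hNU hx) (congrFun h)), ?_⟩
    funext i
    exact (hprin x hx v hv).1 i
  obtain ⟨hp1, hp2⟩ := hprin u hu v hv
  refine ⟨σ u / ρ u - meanLam A u, fun i => (sum_a2_eq_iff A u _ _ i).2 (hp1 i), ?_⟩
  rw [hA.trilin_lam3_eq (hNU hu) (hsd u hu) hdet hp1, hp2, mul_zero]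
  intro h0
  refine hA.a2_ne_smul_g (hNU hu) (hd u (hNU hu)) (σ u / ρ u - meanLam A u) ?_
  rw [← h0]
  ext i j
  simp only [Matrix.sub_apply, Matrix.smul_apply, smul_eq_mul, a2_apply]
  ring

end IsFrameOn

/-! ### Two transversal families, and families recovered from a_{ijk} = 0 -/

namespace IsFrameOn

variable {U : Set E2} {A : Fin 5 → E2 → Poly} (hA : IsFrameOn U A)
include hA

section TwoEnvelopes

variable (hd : ∀ u ∈ U, (a2 A u).det ≠ 0) {N : Set E2} (hNU : N ⊆ U)
    (hN : IsOpen N) {touches : Poly → E2 → Prop}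
    (htouch : ∀ u ∈ N, ∀ S, touches S u → form S (A 0 u) = 0 ∧ ∀ i, form S (A (tg i) u) = 0)
    {t₁ t₂ : E2 → ℝ} (h₁ : IsEnvelope IsSphere touches N t₁) (h₂ : IsEnvelope IsSphere touches N t₂)
    {u : E2} (hu : u ∈ N) (hind : LinearIndependent ℝ ![fderiv ℝ t₁ u, fderiv ℝ t₂ u])
include hd hNU hN htouch h₁ h₂ hu hind

/-- The two characteristics of a twice enveloping surface are the two principal directions. -/
lemma exists_principal_pair : ∃ v₁ ≠ 0, ∃ v₂ ≠ 0, ∃ s ≠ 0,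
    fderiv ℝ t₁ u v₁ = 0 ∧ fderiv ℝ t₂ u v₂ = 0 ∧
    (∀ i, ∑ j, a2 A u i j * omega A u v₁ 0 (tg j) = s * ∑ j, g A u i j * omega A u v₁ 0 (tg j)) ∧
    (∀ i, ∑ j, a2 A u i j * omega A u v₂ 0 (tg j)
      = -s * ∑ j, g A u i j * omega A u v₂ 0 (tg j)) ∧
    trilin (lam3 A u) (fun i => omega A u v₁ 0 (tg i)) (fun i => omega A u v₁ 0 (tg i))
        (fun i => omega A u v₁ 0 (tg i)) = 0 ∧
    trilin (lam3 A u) (fun i => omega A u v₂ 0 (tg i)) (fun i => omega A u v₂ 0 (tg i))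
        (fun i => omega A u v₂ 0 (tg i)) = 0 := by
  have huU := hNU hu
  obtain ⟨v₁, hv₁, ht₁⟩ := exists_ne_zero_apply_eq_zero (fderiv ℝ t₁ u)
  obtain ⟨v₂, hv₂, ht₂⟩ := exists_ne_zero_apply_eq_zero (fderiv ℝ t₂ u)
  obtain ⟨s₁, hs₁, hl₁⟩ := hA.principal_of_isEnvelope hd hNU hN htouch h₁ hu ht₁
  obtain ⟨s₂, hs₂, hl₂⟩ := hA.principal_of_isEnvelope hd hNU hN htouch h₂ hu ht₂
  -- Equal curvatures would make the two characteristic directions proportional, contradicting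
  -- transversality.
  have hne : s₂ ≠ s₁ := by
    rintro rfl
    obtain ⟨c, rfl⟩ := hA.exists_smul_of_principal huU (hd u huU) hv₁ hs₁ hs₂
    exact hv₂ (eq_zero_of_linearIndependent hind (by simp [ht₁]) ht₂)
  have hneg : s₂ = -s₁ := by
    have e1 := hA.det_a2_eq huU hv₁ hs₁
    have e2 := hA.det_a2_eq huU hv₂ hs₂
    have e3 : (s₂ - s₁) * ((s₂ + s₁) * (g A u).det) = 0 := by linear_combination e2 - e1
    have e4 := (mul_eq_zero.1 e3).resolve_left (sub_ne_zero.2 hne)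
    have := (mul_eq_zero.1 e4).resolve_right (hA.g_det_pos huU).ne'
    linarith
  subst hneg
  exact ⟨v₁, hv₁, v₂, hv₂, s₁, hA.ne_zero_of_principal huU (hd u huU) hv₁ hs₁, ht₁, ht₂, hs₁, hs₂,
    hl₁, hl₂⟩

lemma a3_eq_zero_of_envelopes (i j k : Fin 2) : a3 A u i j k = 0 := by
  have huU := hNU hu
  obtain ⟨v₁, hv₁, v₂, hv₂, s, hs, -, -, hs₁, hs₂, hl₁, hl₂⟩ :=
    hA.exists_principal_pair hd hNU hN htouch h₁ h₂ hu hind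
  exact hA.a3_eq_zero huU (hd u huU) hs
    (fun h => hv₁ (hA.eq_zero_of_omega huU (congrFun h)))
    (fun h => hv₂ (hA.eq_zero_of_omega huU (congrFun h))) hs₁ hs₂ hl₁ hl₂ i j k

/-- The only eigenvalues are s and -s, each with a one-dimensional eigenspace already occupied by a
characteristic direction. -/
lemma apply_eq_zero_of_isPrincipal {v : E2} (hv : IsPrincipal A u v) :
    fderiv ℝ t₁ u v = 0 ∨ fderiv ℝ t₂ u v = 0 := by
  have huU := hNU hu
  obtain ⟨v₁, hv₁, v₂, hv₂, s, hs, ht₁, ht₂, hs₁, hs₂, -, -⟩ :=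
    hA.exists_principal_pair hd hNU hN htouch h₁ h₂ hu hind
  obtain ⟨hv0, r, hr⟩ := (hA.isPrincipal_iff huU).1 hv
  have e1 := hA.det_a2_eq huU hv₁ hs₁
  have e2 := hA.det_a2_eq huU hv0 hr
  have e3 : (r - s) * (r + s) * (g A u).det = 0 := by linear_combination e2 - e1
  rcases mul_eq_zero.1 ((mul_eq_zero.1 e3).resolve_right (hA.g_det_pos huU).ne') with h | h
  · obtain rfl : r = s := by linarith
    obtain ⟨c, rfl⟩ := hA.exists_smul_of_principal huU (hd u huU) hv₁ hs₁ hr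
    exact Or.inl (by simp [ht₁])
  · obtain rfl : r = -s := by linarith
    obtain ⟨c, rfl⟩ := hA.exists_smul_of_principal huU (hd u huU) hv₂ hs₂ hr
    exact Or.inr (by simp [ht₂])

end TwoEnvelopes

lemma exists_principal {u : E2} (hu : u ∈ U) {s : ℝ}
    (hs : (a2 A u).det + s ^ 2 * (g A u).det = 0) : ∃ v ≠ 0, ∀ i,
    ∑ j, a2 A u i j * omega A u v 0 (tg j) = s * ∑ j, g A u i j * omega A u v 0 (tg j) := by
  rw [← hA.det_a2_sub hu, ← Matrix.exists_mulVec_eq_zero_iff] at hs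
  obtain ⟨x, hx, h⟩ := hs
  have hω : ∀ i, omega A u (∑ j, x j • dual A u j) 0 (tg i) = x i := by
    intro i
    have h : ∀ j, omega A u (dual A u j) 0 (tg i) = if i = j then 1 else 0 := hA.omega_dual hu i
    simp only [Fin.sum_univ_two, omega_add, omega_smul, Matrix.add_apply, Matrix.smul_apply,
      smul_eq_mul, h]
    fin_cases i <;> simp
  refine ⟨∑ j, x j • dual A u j, fun h0 => hx ?_, fun i => ?_⟩
  · funext i
    rw [← hω i, h0]
    simp [omega, Matrix.mul_apply]
  · have := congrFun h i
    simp only [Matrix.mulVec, dotProduct, Matrix.sub_apply, Matrix.smul_apply, smul_eq_mul,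
      Pi.zero_apply, Fin.sum_univ_two] at this
    simp only [hω]
    simp only [Fin.sum_univ_two]
    linarith

/-- Half of the difference of the principal curvatures. -/
def _root_.ConformalSurface.halfGap (A : Fin 5 → E2 → Poly) (u : E2) : ℝ :=
  √(-(a2 A u).det / (g A u).det)

lemma det_add_halfGap {u : E2} (hu : u ∈ U) {ε : ℝ} (hε : ε ^ 2 = 1) :
    (a2 A u).det + (ε * halfGap A u) ^ 2 * (g A u).det = 0 := by
  have h := (hA.g_det_pos hu)
  rw [mul_pow, hε, halfGap, Real.sq_sqrt (div_nonneg (neg_nonneg.2 (hA.det_a2_nonpos hu)) h.le)]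
  field_simp
  ring

/-- If `a_{ijk}` vanishes, each of the two families of curvature spheres is a one-parameter family
of which the surface is the envelope. -/
lemma exists_isEnvelope_of_a3_eq_zero (hd : ∀ u ∈ U, (a2 A u).det ≠ 0)
    (h3 : ∀ u ∈ U, ∀ i j k, a3 A u i j k = 0) {touches : Poly → E2 → Prop}
    (htouch : ∀ u ∈ U, ∀ S, form S (A 0 u) = 0 → (∀ i, form S (A (tg i) u) = 0) → touches S u)
    {ε : ℝ} (hε : ε ^ 2 = 1) {u₀ : E2} (hu₀ : u₀ ∈ U) :
    ∃ N ⊆ U, IsOpen N ∧ u₀ ∈ N ∧ ∃ t : E2 → ℝ, IsEnvelope IsSphere touches N t ∧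
      ∀ u ∈ N, ∀ v, (∀ i, ∑ j, a2 A u i j * omega A u v 0 (tg j)
        = (ε * halfGap A u) * ∑ j, g A u i j * omega A u v 0 (tg j)) → fderiv ℝ t u v = 0 := by
  -- Absence of umbilics keeps the radicand nonzero, so the square root, and with it each principal
  -- curvature, is smooth.
  have hgap : ContDiffOn ℝ ∞ (halfGap A) U :=
    (((contDiffOn_det hA.contDiffOn_a2).neg).div (contDiffOn_det hA.contDiffOn_g)
      fun u hu => (hA.g_det_pos hu).ne').sqrt
      fun u hu => div_ne_zero (neg_ne_zero.2 (hd u hu)) (hA.g_det_pos hu).ne'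
  set s : E2 → ℝ := fun u => meanLam A u + ε * halfGap A u with hs
  have hss : ContDiffOn ℝ ∞ s U := hA.contDiffOn_meanLam.add (contDiffOn_const.mul hgap)
  have hsd : ∀ u ∈ U, DifferentiableAt ℝ s u := fun u hu =>
    (hss.differentiableOn (by simp)).differentiableAt (hA.isOpen.mem_nhds hu)
  have hsub : ∀ u, lam A u - s u • g A u = a2 A u - (ε * halfGap A u) • g A u := fun u => by
    ext i j
    simp only [Matrix.sub_apply, Matrix.smul_apply, smul_eq_mul, a2_apply, hs]
    ring
  have hiff : ∀ u (x : Fin 2 → ℝ), (∀ i, ∑ j, a2 A u i j * x j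
      = (ε * halfGap A u) * ∑ j, g A u i j * x j)
      ↔ ∀ i, ∑ j, (lam A u i j - s u * g A u i j) * x j = 0 := fun u x => by
    have : ε * halfGap A u = s u - meanLam A u := by simp [hs]
    rw [this]
    exact forall_congr' fun i => sum_a2_eq_iff A u _ _ i
  have hstat : ∀ u ∈ U, ∀ v, (∀ i, ∑ j, a2 A u i j * omega A u v 0 (tg j)
      = (ε * halfGap A u) * ∑ j, g A u i j * omega A u v 0 (tg j)) →
      fderiv ℝ (fun x => A 3 x + s x • A 0 x) u v = 0 := by
    intro u hu v hv
    by_cases hv0 : v = 0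
    · simp [hv0]
    have hv' := (hiff u fun j => omega A u v 0 (tg j)).1 hv
    refine (hA.fderiv_sphere_eq_zero_iff hu (hsd u hu) v).2 ⟨hv', ?_⟩
    have hdet : ∀ᶠ w in nhds u, (lam A w - s w • g A w).det = 0 := by
      filter_upwards [hA.isOpen.mem_nhds hu] with w hw
      rw [hsub, hA.det_a2_sub hw, hA.det_add_halfGap hw hε]
    have h := hA.trilin_lam3_eq hu (hsd u hu) hdet hv'
      (by rw [hsub]; exact hA.a2_ne_smul_g hu (hd u hu) _)
    rw [← hA.trilin_a3_self hu hv] at h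
    have h0 : trilin (a3 A u) (fun i => omega A u v 0 (tg i)) (fun i => omega A u v 0 (tg i))
        (fun i => omega A u v 0 (tg i)) = 0 := by simp [trilin, h3 u hu]
    rw [h0] at h
    exact (mul_eq_zero.1 h.symm).resolve_left
      (hA.bilin_g_pos hu fun h => hv0 (hA.eq_zero_of_omega hu (congrFun h))).ne'
  have hker : ∀ u ∈ U, ∃ v ≠ 0, fderiv ℝ (fun x => A 3 x + s x • A 0 x) u v = 0 := by
    intro u hu
    obtain ⟨v, hv, h⟩ := hA.exists_principal hu (hA.det_add_halfGap hu hε)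
    exact ⟨v, hv, hstat u hu v h⟩
  have hind : ∀ u ∈ U, ∃ w, LinearIndependent ℝ ![A 3 u + s u • A 0 u,
      fderiv ℝ (fun x => A 3 x + s x • A 0 x) u w] := by
    intro u hu
    -- The other principal vector witnesses regularity: it is not principal for this curvature, so
    -- the derivative of the sphere along it has a nonzero `A_1` or `A_2` component, while the
    -- sphere itself lies in the span of `A_3` and `A_0`.
    obtain ⟨v, hv, h⟩ := hA.exists_principal hu (s := - (ε * halfGap A u))
      (by rw [neg_sq]; exact hA.det_add_halfGap hu hε)
    have hne : ¬ ∀ i, ∑ j, (lam A u i j - s u * g A u i j) * omega A u v 0 (tg j) = 0 := by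
      rw [← hiff u fun j => omega A u v 0 (tg j)]
      intro h'
      have hx : (fun i => omega A u v 0 (tg i)) ≠ 0 := fun h =>
        hv (hA.eq_zero_of_omega hu (congrFun h))
      have hs0 := hA.ne_zero_of_principal hu (hd u hu) hv h'
      exact (hA.bilin_g_pos hu hx).ne' (hA.bilin_g_eq_zero hu h' h fun h0 => hs0 (by linarith))
    rw [hA.omega_three_tg_iff hu] at hne
    refine ⟨v, ?_⟩
    rw [LinearIndependent.pair_iff]
    intro a b hab
    rw [hA.fderiv_sphere hu (hsd u hu)] at hab
    set y : Fin 5 → ℝ := ![omega A u v 3 0 + s u * omega A u v 0 0 + fderiv ℝ s u v,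
          omega A u v 3 1 + s u * omega A u v 0 1, omega A u v 3 2 + s u * omega A u v 0 2, 0, 0]
      with hy
    have h4 : ∑ η, (![a * s u + b * y 0, b * y 1, b * y 2, a, 0] : Fin 5 → ℝ) η • A η u = 0 := by
      rw [← hab]
      simp only [Fin.sum_univ_five, Matrix.cons_val, hy]
      module
    have h5 := hA.combination_eq_zero hu h4
    have ha := congrFun h5 3
    have h1 := congrFun h5 1
    have h2 := congrFun h5 2
    simp only [Matrix.cons_val, Pi.zero_apply, hy] at ha h1 h2
    refine ⟨ha, by_contra fun hb => hne ⟨?_, ?_⟩⟩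
    · exact (mul_eq_zero.1 h1).resolve_left hb
    · exact (mul_eq_zero.1 h2).resolve_left hb
  have hsph : ∀ u ∈ U, IsSphere (A 3 u + s u • A 0 u) := by
    intro u hu
    simp only [IsSphere, form_add_left, form_add_right, form_smul_left, form_smul_right,
      hA.three_three u hu, form_comm (A 3 u) (A 0 u), hA.zero_three u hu, hA.null_zero u hu]
    norm_num
  have htou : ∀ u ∈ U, touches (A 3 u + s u • A 0 u) u := by
    intro u hu
    refine htouch u hu _ ?_ fun i => ?_
    · simp only [form_add_left, form_smul_left, form_comm (A 3 u) (A 0 u), hA.zero_three u hu,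
        hA.null_zero u hu]
      norm_num
    · simp only [form_add_left, form_smul_left, form_comm (A 3 u), hA.tg_three u hu,
        hA.zero_tg u hu]
      norm_num
  obtain ⟨N, hNU, hN, huN, t, ht, htv⟩ := exists_isEnvelope hA.isOpen
    ((hA.smooth 3).add (hss.smul (hA.smooth 0))) hker hind hsph htou hu₀
  exact ⟨N, hNU, hN, huN, t, ht, fun u hu v hv => htv u hu v (hstat u (hNU hu) v hv)⟩

end IsFrameOn

/-! ### Frames along an immersed surface in a chart -/

lemma form_lift_self (p : C3) : form (lift p) (lift p) = 0 := by
  have h := p.2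
  rw [mem_sphere_zero_iff_norm, EuclideanSpace.norm_eq, Real.sqrt_eq_one] at h
  simp only [Fin.sum_univ_four, Real.norm_eq_abs, sq_abs] at h
  simp only [form, lift, Matrix.cons_val]
  linarith

lemma lift_four (p : C3) : lift p 4 = 1 := rfl

/-- The vector product of the spatial parts of three vectors. -/
def cross (a b c : Poly) : Poly :=
  ![a 1 * (b 2 * c 3 - b 3 * c 2) - a 2 * (b 1 * c 3 - b 3 * c 1) + a 3 * (b 1 * c 2 - b 2 * c 1),
    -(a 0 * (b 2 * c 3 - b 3 * c 2) - a 2 * (b 0 * c 3 - b 3 * c 0)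
      + a 3 * (b 0 * c 2 - b 2 * c 0)),
    a 0 * (b 1 * c 3 - b 3 * c 1) - a 1 * (b 0 * c 3 - b 3 * c 0) + a 3 * (b 0 * c 1 - b 1 * c 0),
    -(a 0 * (b 1 * c 2 - b 2 * c 1) - a 1 * (b 0 * c 2 - b 2 * c 0)
      + a 2 * (b 0 * c 1 - b 1 * c 0)),
    0]

lemma form_cross_left (a b c : Poly) : form (cross a b c) a = 0 := by
  simp only [form, cross, Matrix.cons_val]; ring

lemma form_cross_middle (a b c : Poly) : form (cross a b c) b = 0 := by
  simp only [form, cross, Matrix.cons_val]; ring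

lemma form_cross_right (a b c : Poly) : form (cross a b c) c = 0 := by
  simp only [form, cross, Matrix.cons_val]; ring

/-- `form a b + a 4 * b 4` is the Euclidean product of the spatial parts, so the right side is their
Gram determinant. -/
lemma form_cross_self (a b c : Poly) : form (cross a b c) (cross a b c) =
    (form a a + a 4 * a 4) * ((form b b + b 4 * b 4) * (form c c + c 4 * c 4)
        - (form b c + b 4 * c 4) ^ 2)
      - (form a b + a 4 * b 4) * ((form a b + a 4 * b 4) * (form c c + c 4 * c 4)
        - (form b c + b 4 * c 4) * (form a c + a 4 * c 4))
      + (form a c + a 4 * c 4) * ((form a b + a 4 * b 4) * (form b c + b 4 * c 4)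
        - (form b b + b 4 * b 4) * (form a c + a 4 * c 4)) := by
  simp only [form, cross, Matrix.cons_val]; ring

lemma _root_.ContDiffOn.cross {n : WithTop ℕ∞} {a b c : E2 → Poly} {U : Set E2}
    (ha : ContDiffOn ℝ n a U) (hb : ContDiffOn ℝ n b U) (hc : ContDiffOn ℝ n c U) :
    ContDiffOn ℝ n (fun u => cross (a u) (b u) (c u)) U := by
  have h : ∀ i j k, ContDiffOn ℝ n (fun u => a u i * (b u j * c u k - b u k * c u j)) U :=
    fun i j k => (contDiffOn_pi.1 ha i).mul
      (((contDiffOn_pi.1 hb j).mul (contDiffOn_pi.1 hc k)).sub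
        ((contDiffOn_pi.1 hb k).mul (contDiffOn_pi.1 hc j)))
  rw [contDiffOn_pi]
  intro i
  fin_cases i
  · exact ((h 1 2 3).sub (h 2 1 3)).add (h 3 1 2)
  · exact (((h 0 2 3).sub (h 2 0 3)).add (h 3 0 2)).neg
  · exact ((h 0 1 3).sub (h 1 0 3)).add (h 3 0 1)
  · exact (((h 0 1 2).sub (h 1 0 2)).add (h 2 0 1)).neg
  · exact contDiffOn_const

section Frame

variable {M : Type*} [TopologicalSpace M]

/-- The surface `f` is smoothly immersed over the domain of the chart `e`. -/
structure IsImmersedAlong (f : M → C3) (e : OpenPartialHomeomorph M E2) : Prop where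
  smooth : ContDiffOn ℝ ∞ (fun u => lift (f (e.symm u))) e.target
  injective : ∀ u ∈ e.target, ∀ v, fderiv ℝ (fun u => lift (f (e.symm u))) u v = 0 → v = 0

variable {f : M → C3} {e : OpenPartialHomeomorph M E2}

namespace IsImmersedAlong

variable (hf : IsImmersedAlong f e)
include hf

lemma differentiableAt {u : E2} (hu : u ∈ e.target) :
    DifferentiableAt ℝ (fun u => lift (f (e.symm u))) u :=
  (hf.smooth.differentiableOn (by simp)).differentiableAt (e.open_target.mem_nhds hu)

lemma fderiv_four {u : E2} (hu : u ∈ e.target) (v : E2) :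
    fderiv ℝ (fun u => lift (f (e.symm u))) u v 4 = 0 := by
  have h := (hasFDerivAt_pi'.1 (hf.differentiableAt hu).hasFDerivAt) 4
  have h' := (h.unique (hasFDerivAt_const (1 : ℝ) u))
  exact congrArg (fun L : E2 →L[ℝ] ℝ => L v) h'

lemma form_lift_fderiv {u : E2} (hu : u ∈ e.target) (v : E2) :
    form (lift (f (e.symm u))) (fderiv ℝ (fun u => lift (f (e.symm u))) u v) = 0 := by
  have h := form_fderiv_eq_zero e.open_target (hf.smooth.differentiableOn (by simp))
    (hf.smooth.differentiableOn (by simp)) (fun u _ => form_lift_self (f (e.symm u))) hu v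
  rw [form_comm (fderiv ℝ _ u v)] at h
  linarith

/-- The last coordinate of the derivative is zero, and on such vectors the form is the Euclidean
scalar product. -/
lemma form_fderiv_pos {u : E2} (hu : u ∈ e.target) {v : E2} (hv : v ≠ 0) :
    0 < form (fderiv ℝ (fun u => lift (f (e.symm u))) u v)
      (fderiv ℝ (fun u => lift (f (e.symm u))) u v) := by
  have h4 := hf.fderiv_four hu v
  have hne : fderiv ℝ (fun u => lift (f (e.symm u))) u v ≠ 0 := fun h => hv (hf.injective u hu v h)
  set Y := fderiv ℝ (fun u => lift (f (e.symm u))) u v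
  simp only [form, h4]
  by_contra hc
  have h0 := mul_self_nonneg (Y 0)
  have h1 := mul_self_nonneg (Y 1)
  have h2 := mul_self_nonneg (Y 2)
  have h3 := mul_self_nonneg (Y 3)
  have e0 : Y 0 = 0 := mul_self_eq_zero.1 (by linarith)
  have e1 : Y 1 = 0 := mul_self_eq_zero.1 (by linarith)
  have e2 : Y 2 = 0 := mul_self_eq_zero.1 (by linarith)
  have e3 : Y 3 = 0 := mul_self_eq_zero.1 (by linarith)
  refine hne (funext fun k => ?_)
  fin_cases k <;> assumption

/-- `lift` has last coordinate 1, so the scale factor is the last coordinate of `A_0`; it is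
therefore smooth and the product rule applies. -/
lemma exists_scale [ChartedSpace E2 M] {A : Fin 5 → E2 → Poly}
    (hA : IsFirstOrderFrame f e A) {u : E2}
    (hu : u ∈ e.target) (v : E2) : ∃ c : ℝ, c ≠ 0 ∧ A 0 u = c • lift (f (e.symm u)) ∧ ∃ d : ℝ,
      fderiv ℝ (A 0) u v
        = c • fderiv ℝ (fun u => lift (f (e.symm u))) u v + d • lift (f (e.symm u)) := by
  have hn := e.open_target.mem_nhds hu
  have heq : ∀ w ∈ e.target, A 0 w = A 0 w 4 • lift (f (e.symm w)) := fun w hw => by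
    obtain ⟨c, -, h⟩ := hA.point w hw
    rw [h]; simp [lift_four]
  have hd : DifferentiableAt ℝ (fun w => A 0 w 4) u :=
    differentiableAt_pi.1 (((hA.smooth 0).differentiableOn (by simp)).differentiableAt hn) 4
  refine ⟨A 0 u 4, ?_, heq u hu, fderiv ℝ (fun w => A 0 w 4) u v, ?_⟩
  · obtain ⟨c, hc, h⟩ := hA.point u hu
    rw [h]; simpa [lift_four] using hc
  · have h1 : A 0 =ᶠ[nhds u] fun w => A 0 w 4 • lift (f (e.symm w)) := by
      filter_upwards [hn] with w hw using heq w hw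
    have h2 : fderiv ℝ (fun w => A 0 w 4 • lift (f (e.symm w))) u = _ :=
      (hd.hasFDerivAt.smul (hf.differentiableAt hu).hasFDerivAt).fderiv
    rw [h1.fderiv_eq, h2]
    rfl

lemma isFrameOn [ChartedSpace E2 M] {A : Fin 5 → E2 → Poly} (hA : IsFirstOrderFrame f e A) :
    IsFrameOn e.target A where
  isOpen := e.open_target
  smooth := hA.smooth
  null_zero := hA.null_zero
  null_four := hA.null_four
  zero_four := hA.zero_four
  zero_three := hA.zero_three
  four_three := hA.four_three
  three_three := hA.three_three
  zero_tg := hA.zero_tg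
  four_tg := hA.four_tg
  tg_three := hA.tg_three
  metric := hA.metric
  tangent := hA.tangent
  immersed := by
    rintro u hu v ⟨k, hk⟩
    obtain ⟨c, hc, h1, d, h2⟩ := hf.exists_scale hA hu v
    rw [h2, h1] at hk
    -- The derivative of `lift` has last coordinate 0, so the last coordinates give d = k c and the
    -- multiples of `lift` cancel.
    have h4 := congrFun hk 4
    simp only [Pi.add_apply, Pi.smul_apply, smul_eq_mul, hf.fderiv_four hu, lift_four] at h4
    refine hf.injective u hu v ?_
    have h5 : c • fderiv ℝ (fun u => lift (f (e.symm u))) u v = 0 := by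
      have h6 : d = k * c := by linarith
      rw [h6, smul_smul] at hk
      simpa using hk
    exact (smul_eq_zero.1 h5).resolve_left hc

/-- Modulo `A_0`, the vectors `A_1`, `A_2` are the derivatives of `A_0` along the dual basis, and
`A_0` is a nonzero multiple of `lift`; both conditions thus concern orthogonality to the same
subspace. -/
lemma touches_iff [ChartedSpace E2 M] {A : Fin 5 → E2 → Poly}
    (hA : IsFirstOrderFrame f e A) {u : E2}
    (hu : u ∈ e.target) (S : Poly) :
    Touches f e S u ↔ form S (A 0 u) = 0 ∧ ∀ i, form S (A (tg i) u) = 0 := by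
  have hF := hf.isFrameOn hA
  constructor
  · rintro ⟨h0, ht⟩
    have h1 : form S (A 0 u) = 0 := by
      obtain ⟨c, -, h⟩ := hA.point u hu
      rw [h, form_smul_right, h0, mul_zero]
    refine ⟨h1, fun i => ?_⟩
    obtain ⟨c, -, -, d, h2⟩ := hf.exists_scale hA hu (dual A u i)
    have h3 : form S (fderiv ℝ (A 0) u (dual A u i)) = 0 := by
      rw [h2, form_add_right, form_smul_right, form_smul_right, ht, h0]; ring
    have hd (j : Fin 2) := hF.omega_dual hu j i
    have hd0 := hd 0
    have hd1 := hd 1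
    simp only [tg, Matrix.cons_val_zero, Matrix.cons_val_one] at hd0 hd1
    rw [hF.fderiv_eq hu, Fin.sum_univ_five, hF.omega_zero_three hu, hF.omega_zero_four hu, hd0,
      hd1] at h3
    simp only [form_add_right, form_smul_right, h1] at h3
    fin_cases i
    · simpa [tg] using h3
    · simpa [tg] using h3
  · rintro ⟨h0, ht⟩
    have h1 : form S (lift (f (e.symm u))) = 0 := by
      obtain ⟨c, hc, h⟩ := hA.point u hu
      rw [h, form_smul_right] at h0
      exact (mul_eq_zero.1 h0).resolve_left hc
    refine ⟨h1, fun v => ?_⟩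
    obtain ⟨c, hc, -, d, h2⟩ := hf.exists_scale hA hu v
    have h3 : form S (fderiv ℝ (A 0) u v) = 0 := by
      have t1 : form S (A 1 u) = 0 := ht 0
      have t2 : form S (A 2 u) = 0 := ht 1
      rw [hF.fderiv_eq hu, Fin.sum_univ_five, hF.omega_zero_three hu, hF.omega_zero_four hu]
      simp only [form_add_right, form_smul_right, h0, t1, t2]
      ring
    rw [h2, form_add_right, form_smul_right, form_smul_right, h1, mul_zero, add_zero] at h3
    exact (mul_eq_zero.1 h3).resolve_left hc

/-- Every immersed surface has a first-order frame over the domain of each chart. -/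
lemma exists_frame [ChartedSpace E2 M] : ∃ A, IsFirstOrderFrame f e A := by
  set X : E2 → Poly := fun u => lift (f (e.symm u)) with hX
  set B : Fin 2 → E2 → Poly := fun i u => fderiv ℝ X u (EuclideanSpace.single i 1) with hB
  set n : E2 → Poly := fun u => cross (X u) (B 0 u) (B 1 u) with hn
  -- `A_4` is half the null vector of the antipodal point; the factor 1/2 gives (`A_0`, `A_4`) = -1.
  set q : E2 → Poly := fun u => (1 / 2 : ℝ) • ![-X u 0, -X u 1, -X u 2, -X u 3, 1] with hq
  have hBs : ∀ i, ContDiffOn ℝ ∞ (B i) e.target := fun i =>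
    (hf.smooth.fderiv_of_isOpen e.open_target (by simp)).clm_apply contDiffOn_const
  have hns : ContDiffOn ℝ ∞ n e.target := hf.smooth.cross (hBs 0) (hBs 1)
  have hXX : ∀ u, form (X u) (X u) = 0 := fun u => form_lift_self _
  have hX4 : ∀ u, X u 4 = 1 := fun u => rfl
  have hB4 : ∀ i, ∀ u ∈ e.target, B i u 4 = 0 := fun i u hu => hf.fderiv_four hu _
  have hXB : ∀ i, ∀ u ∈ e.target, form (X u) (B i u) = 0 := fun i u hu => hf.form_lift_fderiv hu _
  have hqs : ∀ u (Y : Poly), form (q u) Y = - (1 / 2) * form (X u) Y - Y 4 := fun u Y => by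
    simp only [hq, form, Pi.smul_apply, smul_eq_mul, Matrix.cons_val, hX4]; ring
  have hgpos : ∀ u ∈ e.target, ∀ x : Fin 2 → ℝ, x ≠ 0 →
      0 < x 0 * x 0 * form (B 0 u) (B 0 u) + 2 * (x 0 * x 1 * form (B 0 u) (B 1 u))
        + x 1 * x 1 * form (B 1 u) (B 1 u) := by
    intro u hu x hx
    have hv : ∑ i, x i • EuclideanSpace.single i (1 : ℝ) ≠ 0 := fun h => hx <| by
      funext i
      have := congrFun (congrArg (fun x : E2 => (x : Fin 2 → ℝ)) h) i
      fin_cases i <;> simpa [Fin.sum_univ_two] using this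
    have h := hf.form_fderiv_pos hu hv
    have hv' : fderiv ℝ X u (∑ i, x i • EuclideanSpace.single i (1 : ℝ))
        = x 0 • B 0 u + x 1 • B 1 u := by
      simp only [Fin.sum_univ_two, map_add, map_smul, hB]
    rw [← hX, hv'] at h
    simp only [form_add_left, form_add_right, form_smul_left, form_smul_right,
      form_comm (B 1 u) (B 0 u)] at h
    linarith
  have hnn : ∀ u ∈ e.target, 0 < form (n u) (n u) := by
    intro u hu
    have h0 := hgpos u hu ![1, 0] (fun h => by simpa using congrFun h 0)
    -- On (-g_{01}, g_{00}) the quadratic form takes the value g_{00} det g. Since the spatial part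
    -- of X is a unit vector orthogonal to those of `B 0` and `B 1`, det g is also the square of n.
    have h1 := hgpos u hu ![-form (B 0 u) (B 1 u), form (B 0 u) (B 0 u)] (fun h => by
      have := congrFun h 1
      simp only [Matrix.cons_val_zero, Matrix.cons_val_one, Pi.zero_apply] at h0 this
      rw [this] at h0
      norm_num at h0)
    simp only [Matrix.cons_val_zero, Matrix.cons_val_one] at h0 h1
    have h0' : 0 < form (B 0 u) (B 0 u) := by linarith
    rw [hn, form_cross_self, hXX, hX4, hXB 0 u hu, hXB 1 u hu, hB4 0 u hu, hB4 1 u hu]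
    refine (mul_pos_iff_of_pos_left h0').1 ?_
    linarith
  have hnB : ∀ u, form (n u) (B 0 u) = 0 ∧ form (n u) (B 1 u) = 0 := fun u =>
    ⟨form_cross_middle _ _ _, form_cross_right _ _ _⟩
  have hnX : ∀ u, form (n u) (X u) = 0 := fun u => form_cross_left _ _ _
  have hXn : ∀ u, form (X u) (n u) = 0 := fun u => (form_comm _ _).trans (hnX u)
  have hBn : ∀ i u, form (B i u) (n u) = 0 := fun i u => by
    rw [form_comm]
    fin_cases i
    exacts [(hnB u).1, (hnB u).2]
  have hn4 : ∀ u, n u 4 = 0 := fun u => rfl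
  refine ⟨![X, B 0, B 1, fun u => (√(form (n u) (n u)))⁻¹ • n u, q], ?_⟩
  have htg : ∀ i, (![X, B 0, B 1, fun u => (√(form (n u) (n u)))⁻¹ • n u, q] : Fin 5 → E2 → Poly)
      (tg i) = B i := fun i => by fin_cases i <;> rfl
  refine ⟨?_, ?_, ?_, ?_, ?_, ?_, ?_, ?_, ?_, ?_, ?_, ?_, ?_⟩
  · intro ξ
    fin_cases ξ
    · exact hf.smooth
    · exact hBs 0
    · exact hBs 1
    · exact (((hns.form hns).sqrt fun u hu => (hnn u hu).ne').inv
        fun u hu => (Real.sqrt_pos.2 (hnn u hu)).ne').smul hns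
    · have h := contDiffOn_pi.1 hf.smooth
      have h' : ContDiffOn ℝ ∞ (fun u => ![-X u 0, -X u 1, -X u 2, -X u 3, 1]) e.target := by
        refine contDiffOn_pi.2 fun k => ?_
        fin_cases k
        exacts [(h 0).neg, (h 1).neg, (h 2).neg, (h 3).neg, contDiffOn_const]
      exact (contDiffOn_const (c := (1 / 2 : ℝ))).smul h'
  · exact fun u _ => ⟨1, one_ne_zero, by rw [one_smul]; rfl⟩
  · exact fun u _ => hXX u
  · intro u _
    change form (q u) (q u) = 0
    rw [hqs, form_comm, hqs, hXX, hX4]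
    simp [hq]
  · intro u _
    change form (X u) (q u) = -1
    rw [form_comm, hqs, hXX, hX4]; norm_num
  · intro u _
    change form (X u) (_ • n u) = 0
    rw [form_smul_right, hXn, mul_zero]
  · intro u _
    change form (q u) (_ • n u) = 0
    rw [form_smul_right, hqs, hXn, hn4]; norm_num
  · intro u hu
    change form (_ • n u) (_ • n u) = 1
    rw [form_smul_right, form_smul_left, ← mul_assoc, ← mul_inv, Real.mul_self_sqrt (hnn u hu).le,
      inv_mul_cancel₀ (hnn u hu).ne']
  · intro u hu i
    rw [htg]
    exact hXB i u hu
  · intro u hu i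
    rw [htg]
    change form (q u) (B i u) = 0
    rw [hqs, hXB i u hu, hB4 i u hu]; norm_num
  · intro u hu i
    rw [htg]
    change form (B i u) (_ • n u) = 0
    rw [form_smul_right, hBn, mul_zero]
  · intro u hu
    refine Matrix.PosDef.of_dotProduct_mulVec_pos ?_ fun x hx => ?_
    · ext i j
      exact g_symm _ u j i
    · have := hgpos u hu x hx
      simp only [dotProduct, Matrix.mulVec, Fin.sum_univ_two, g, htg, Matrix.of_apply,
        Pi.star_apply, star_trivial, form_comm (B 1 u) (B 0 u)]
      linarith
  · intro u hu v
    change form (fderiv ℝ X u v) (_ • n u) = 0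
    have hv : fderiv ℝ X u v = v 0 • B 0 u + v 1 • B 1 u := by
      have : v = v 0 • EuclideanSpace.single 0 (1 : ℝ) + v 1 • EuclideanSpace.single 1 (1 : ℝ) := by
        ext i; fin_cases i <;> simp
      conv_lhs => rw [this]
      simp only [map_add, map_smul, hB]
    rw [hv, form_smul_right, form_add_left, form_smul_left, form_smul_left, hBn, hBn]
    ring

end IsImmersedAlong

end Frame

/-! ### Equivalences for surfaces in the conformal space -/

section

section Envelope

variable {F F' : Type*} [NormedAddCommGroup F] [NormedSpace ℝ F] [NormedAddCommGroup F']
  [NormedSpace ℝ F'] {isSphere : F → Prop} {touches : F → E2 → Prop} {N : Set E2} {t : E2 → ℝ}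

lemma IsEnvelope.mono (h : IsEnvelope isSphere touches N t) {N' : Set E2} (hN : N' ⊆ N) :
    IsEnvelope isSphere touches N' t := by
  obtain ⟨ht, hdt, R, hR, hRs, htou⟩ := h
  have hi := Set.image_mono (f := t) hN
  exact ⟨ht.mono hN, fun u hu => hdt u (hN hu), R, hR.mono hi, fun τ hτ => hRs τ (hi hτ),
    fun u hu => htou u (hN hu)⟩

lemma IsEnvelope.map (h : IsEnvelope isSphere touches N t) (hN : IsOpen N) (T : F ≃L[ℝ] F')
    {isSphere' : F' → Prop} {touches' : F' → E2 → Prop} (hs : ∀ q, isSphere q → isSphere' (T q))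
    (ht : ∀ u ∈ N, ∀ q, touches q u → touches' (T q) u) : IsEnvelope isSphere' touches' N t := by
  obtain ⟨hts, hdt, R, hR, hRs, htou⟩ := h
  refine ⟨hts, hdt, fun τ => T (R τ), T.contDiff.comp_contDiffOn hR,
    fun τ hτ => ⟨hs _ (hRs τ hτ).1, ?_⟩,
    fun u hu => ht u hu _ (htou u hu)⟩
  have hd : HasDerivAt R (deriv R τ) τ := ((hR.differentiableOn (by simp)).differentiableAt
    ((isOpen_image_of_submersion hN hts hdt).mem_nhds hτ)).hasDerivAt
  have hd' : deriv (fun τ => T (R τ)) τ = T (deriv R τ) :=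
    (T.toContinuousLinearMap.hasFDerivAt.comp_hasDerivAt τ hd).deriv
  have hT : ![T (R τ), T (deriv R τ)] = (T : F →ₗ[ℝ] F') ∘ ![R τ, deriv R τ] := by
    funext i
    fin_cases i <;> rfl
  rw [hd', hT]
  exact (hRs τ hτ).2.map' (T : F →ₗ[ℝ] F') (LinearMap.ker_eq_bot.2 T.injective)

lemma linearIndependent_of_kernels {φ ψ : E2 →L[ℝ] ℝ} (hφ : φ ≠ 0) (hψ : ψ ≠ 0) {v w : E2}
    (hv : v ≠ 0) (hw : w ≠ 0) (h1 : φ v = 0) (h2 : ψ w = 0) (hvw : ∀ c : ℝ, w ≠ c • v)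
    (hwv : ∀ c : ℝ, v ≠ c • w) : LinearIndependent ℝ ![φ, ψ] := by
  have hφw : φ w ≠ 0 := fun h => by
    obtain ⟨c, hc⟩ := exists_smul_eq_of_apply_eq_zero hφ hv h1 h
    exact hvw c hc
  have hψv : ψ v ≠ 0 := fun h => by
    obtain ⟨c, hc⟩ := exists_smul_eq_of_apply_eq_zero hψ hw h2 h
    exact hwv c hc
  rw [LinearIndependent.pair_iff]
  intro a b hab
  have ev := congrArg (fun L : E2 →L[ℝ] ℝ => L v) hab
  have ew := congrArg (fun L : E2 →L[ℝ] ℝ => L w) hab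
  simp [h1, h2] at ev ew
  exact ⟨ew.resolve_right hφw, ev.resolve_right hψv⟩

end Envelope

variable {M : Type*} [TopologicalSpace M] [ChartedSpace E2 M]

/-- Over each chart of an immersed surface without umbilics, the two principal directions are
independent. -/
lemma IsFrameOn.exists_principal_basis {U : Set E2} {A : Fin 5 → E2 → Poly} (hA : IsFrameOn U A)
    {u : E2} (hu : u ∈ U) (hd : (a2 A u).det ≠ 0) : ∃ v ≠ 0, ∃ w ≠ 0,
    (∀ c : ℝ, w ≠ c • v) ∧ (∀ c : ℝ, v ≠ c • w) ∧
    (∀ i, ∑ j, a2 A u i j * omega A u v 0 (tg j)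
      = (1 * halfGap A u) * ∑ j, g A u i j * omega A u v 0 (tg j)) ∧
    ∀ i, ∑ j, a2 A u i j * omega A u w 0 (tg j)
      = (-1 * halfGap A u) * ∑ j, g A u i j * omega A u w 0 (tg j) := by
  obtain ⟨v, hv, h1⟩ := hA.exists_principal hu (hA.det_add_halfGap hu (ε := 1) (by norm_num))
  obtain ⟨w, hw, h2⟩ := hA.exists_principal hu (hA.det_add_halfGap hu (ε := -1) (by norm_num))
  have hs := hA.ne_zero_of_principal hu hd hv h1
  have key : ∀ x : E2, x ≠ 0 → (∀ i, ∑ j, a2 A u i j * omega A u x 0 (tg j)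
      = (1 * halfGap A u) * ∑ j, g A u i j * omega A u x 0 (tg j)) →
      (∀ i, ∑ j, a2 A u i j * omega A u x 0 (tg j)
      = (-1 * halfGap A u) * ∑ j, g A u i j * omega A u x 0 (tg j)) → False := by
    intro x hx e1 e2
    exact (hA.bilin_g_pos hu fun h => hx (hA.eq_zero_of_omega hu (congrFun h))).ne'
      (hA.bilin_g_eq_zero hu e1 e2 fun h => hs (by linarith))
  have scale : ∀ (x : E2) (c s : ℝ), (∀ i, ∑ j, a2 A u i j * omega A u x 0 (tg j)
      = s * ∑ j, g A u i j * omega A u x 0 (tg j)) →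
      ∀ i, ∑ j, a2 A u i j * omega A u (c • x) 0 (tg j)
        = s * ∑ j, g A u i j * omega A u (c • x) 0 (tg j) := by
    intro x c s h i
    have := h i
    simp only [omega_smul, Matrix.smul_apply, smul_eq_mul, Fin.sum_univ_two] at this ⊢
    linear_combination c * this
  refine ⟨v, hv, w, hw, fun c hc => ?_, fun c hc => ?_, h1, h2⟩
  · exact key w hw (by rw [hc]; exact scale v c _ h1) h2
  · exact key v hv h1 (by rw [hc]; exact scale w c _ h2)

section Conformal

variable {f : M → C3}
  (himm : ∀ e ∈ IsManifold.maximalAtlas (𝓡 2) ∞ M, IsImmersedAlong f e) (hnd : IsNondegenerate f)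
include himm hnd

lemma thirdTensorVanishes_of_isDupinCyclide (h : IsDupinCyclide f) : ThirdTensorVanishes f := by
  intro e he A hA u hu
  obtain ⟨N, hN, hNo, huN, t₁, t₂, h₁, h₂, hind⟩ := h e he u hu
  exact ((himm e he).isFrameOn hA).a3_eq_zero_of_envelopes (hnd e he A hA) hN hNo
    (fun u hu S => ((himm e he).touches_iff hA (hN hu) S).1) h₁ h₂ huN (hind u huN)

lemma isCanal_of_isDupinCyclide (h : IsDupinCyclide f) : IsCanal f := by
  intro e he A hA u hu v hv
  obtain ⟨N, hN, hNo, huN, t₁, t₂, h₁, h₂, hind⟩ := h e he u hu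
  rcases ((himm e he).isFrameOn hA).apply_eq_zero_of_isPrincipal (hnd e he A hA) hN hNo
    (fun u hu S => ((himm e he).touches_iff hA (hN hu) S).1) h₁ h₂ huN (hind u huN) hv with h | h
  · exact ⟨N, hN, hNo, huN, t₁, h₁, h⟩
  · exact ⟨N, hN, hNo, huN, t₂, h₂, h⟩

lemma isDupinCyclide_of_thirdTensorVanishes (h : ThirdTensorVanishes f) : IsDupinCyclide f := by
  intro e he u hu
  obtain ⟨A, hA⟩ := (himm e he).exists_frame
  have hF := (himm e he).isFrameOn hA
  have htou : ∀ u ∈ e.target, ∀ S, form S (A 0 u) = 0 → (∀ i, form S (A (tg i) u) = 0) →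
      Touches f e S u := fun u hu S h1 h2 => ((himm e he).touches_iff hA hu S).2 ⟨h1, h2⟩
  obtain ⟨N₁, hN₁, ho₁, hu₁, t₁, h₁, hv₁⟩ := hF.exists_isEnvelope_of_a3_eq_zero (hnd e he A hA)
    (h e he A hA) htou (ε := 1) (by norm_num) hu
  obtain ⟨N₂, hN₂, ho₂, hu₂, t₂, h₂, hv₂⟩ := hF.exists_isEnvelope_of_a3_eq_zero (hnd e he A hA)
    (h e he A hA) htou (ε := -1) (by norm_num) hu
  refine ⟨N₁ ∩ N₂, fun x hx => hN₁ hx.1, ho₁.inter ho₂, ⟨hu₁, hu₂⟩, t₁, t₂,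
    h₁.mono Set.inter_subset_left, h₂.mono Set.inter_subset_right, fun x hx => ?_⟩
  obtain ⟨v, hv, w, hw, hwv, hvw, e1, e2⟩ :=
    hF.exists_principal_basis (hN₁ hx.1) (hnd e he A hA x (hN₁ hx.1))
  exact linearIndependent_of_kernels (h₁.2.1 x hx.1) (h₂.2.1 x hx.2) hv hw (hv₁ x hx.1 v e1)
    (hv₂ x hx.2 w e2) hwv hvw

/-- The canal property controls each characteristic only at the chosen point. The two differentials
are independent there, and independence is an open condition. -/
lemma isDupinCyclide_of_isCanal (h : IsCanal f) : IsDupinCyclide f := by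
  intro e he u hu
  obtain ⟨A, hA⟩ := (himm e he).exists_frame
  have hF := (himm e he).isFrameOn hA
  obtain ⟨v, hv, w, hw, hwv, hvw, e1, e2⟩ :=
    hF.exists_principal_basis hu (hnd e he A hA u hu)
  obtain ⟨N₁, hN₁, ho₁, hu₁, t₁, h₁, hv₁⟩ :=
    h e he A hA u hu v ((hF.isPrincipal_iff hu).2 ⟨hv, _, e1⟩)
  obtain ⟨N₂, hN₂, ho₂, hu₂, t₂, h₂, hv₂⟩ :=
    h e he A hA u hu w ((hF.isPrincipal_iff hu).2 ⟨hw, _, e2⟩)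
  have hind : LinearIndependent ℝ ![fderiv ℝ t₁ u, fderiv ℝ t₂ u] :=
    linearIndependent_of_kernels (h₁.2.1 u hu₁) (h₂.2.1 u hu₂) hv hw hv₁ hv₂ hwv hvw
  have hc : ContinuousOn (fun x => ![fderiv ℝ t₁ x, fderiv ℝ t₂ x]) (N₁ ∩ N₂) := by
    have c1 : ContinuousOn (fderiv ℝ t₁) N₁ :=
      (h₁.1.fderiv_of_isOpen (m := ∞) ho₁ (by simp)).continuousOn
    have c2 : ContinuousOn (fderiv ℝ t₂) N₂ :=
      (h₂.1.fderiv_of_isOpen (m := ∞) ho₂ (by simp)).continuousOn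
    refine continuousOn_pi.2 fun i => ?_
    fin_cases i
    exacts [c1.mono Set.inter_subset_left, c2.mono Set.inter_subset_right]
  refine ⟨(N₁ ∩ N₂) ∩ (fun x => ![fderiv ℝ t₁ x, fderiv ℝ t₂ x]) ⁻¹'
    {φ | LinearIndependent ℝ φ}, fun x hx => hN₁ hx.1.1,
    hc.isOpen_inter_preimage (ho₁.inter ho₂) isOpen_setOfPred_linearIndependent,
    ⟨⟨hu₁, hu₂⟩, hind⟩, t₁, t₂, h₁.mono fun x hx => hx.1.1, h₂.mono fun x hx => hx.1.2,
    fun x hx => hx.2⟩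

/-- The two characterizations of Dupin cyclides in the conformal space. -/
lemma isDupinCyclide_iff : (IsDupinCyclide f ↔ ThirdTensorVanishes f) ∧
    (IsDupinCyclide f ↔ IsCanal f) :=
  ⟨⟨thirdTensorVanishes_of_isDupinCyclide himm hnd, isDupinCyclide_of_thirdTensorVanishes himm hnd⟩,
    ⟨isCanal_of_isDupinCyclide himm hnd, isDupinCyclide_of_isCanal himm hnd⟩⟩

end Conformal

section Immersion

variable {V : Type*} [NormedAddCommGroup V] [NormedSpace ℝ V]

lemma immersion_in_chart {F : M → V} (hF : ContMDiff (𝓡 2) 𝓘(ℝ, V) ∞ F)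
    (hinj : ∀ x, Function.Injective (mfderiv (𝓡 2) 𝓘(ℝ, V) F x))
    {e : OpenPartialHomeomorph M E2} (he : e ∈ IsManifold.maximalAtlas (𝓡 2) ∞ M) :
    ContDiffOn ℝ ∞ (fun u => F (e.symm u)) e.target ∧
      ∀ u ∈ e.target, ∀ v, fderiv ℝ (fun u => F (e.symm u)) u v = 0 → v = 0 := by
  have hs := contMDiffOn_symm_of_mem_maximalAtlas he
  have hd : e.MDifferentiable (𝓡 2) (𝓡 2) :=
    ⟨(contMDiffOn_of_mem_maximalAtlas he).mdifferentiableOn (by simp),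
      hs.mdifferentiableOn (by simp)⟩
  refine ⟨contMDiffOn_iff_contDiffOn.1 (hF.comp_contMDiffOn hs), fun u hu v hv => ?_⟩
  have h1 : MDifferentiableAt (𝓡 2) (𝓡 2) e.symm u :=
    (hd.2 u hu).mdifferentiableAt (e.open_target.mem_nhds hu)
  have h2 : MDifferentiableAt (𝓡 2) 𝓘(ℝ, V) F (e.symm u) :=
    hF.mdifferentiable (by simp) _
  have h3 : mfderiv 𝓘(ℝ, E2) 𝓘(ℝ, V) (fun u => F (e.symm u)) u
      = (mfderiv (𝓡 2) 𝓘(ℝ, V) F (e.symm u)).comp (mfderiv (𝓡 2) (𝓡 2) e.symm u) :=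
    mfderiv_comp u h2 h1
  rw [mfderiv_eq_fderiv] at h3
  have h4 : fderiv ℝ (fun u => F (e.symm u)) u v
      = mfderiv (𝓡 2) 𝓘(ℝ, V) F (e.symm u) (mfderiv (𝓡 2) (𝓡 2) e.symm u v) := by
    rw [h3]; rfl
  rw [hv] at h4
  have h5 : mfderiv (𝓡 2) (𝓡 2) e.symm u v = 0 :=
    hinj _ (h4.symm.trans (map_zero (mfderiv (𝓡 2) 𝓘(ℝ, V) F (e.symm u))).symm)
  exact hd.symm.mfderiv_injective hu (h5.trans (map_zero _).symm)

/-- The inclusion of the sphere in ℝ⁴ is an immersion, and `lift` only adds a constant coordinate.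
-/
lemma isImmersedAlong_of_contMDiff {f : M → C3} (hf : ContMDiff (𝓡 2) (𝓡 3) ∞ f)
    (hinj : ∀ x, Function.Injective (mfderiv (𝓡 2) (𝓡 3) f x))
    {e : OpenPartialHomeomorph M E2} (he : e ∈ IsManifold.maximalAtlas (𝓡 2) ∞ M) :
    IsImmersedAlong f e := by
  have : Fact (Module.finrank ℝ (EuclideanSpace ℝ (Fin 4)) = 3 + 1) := ⟨by simp⟩
  have hc : ContMDiff (𝓡 3) 𝓘(ℝ, EuclideanSpace ℝ (Fin 4)) ∞
      ((↑) : C3 → EuclideanSpace ℝ (Fin 4)) := contMDiff_coe_sphere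
  have hF : ContMDiff (𝓡 2) 𝓘(ℝ, EuclideanSpace ℝ (Fin 4)) ∞
      (fun x => (f x : EuclideanSpace ℝ (Fin 4))) := hc.comp hf
  have hFinj : ∀ x, Function.Injective (mfderiv (𝓡 2) 𝓘(ℝ, EuclideanSpace ℝ (Fin 4))
      (fun x => (f x : EuclideanSpace ℝ (Fin 4))) x) := by
    intro x
    have h : mfderiv (𝓡 2) 𝓘(ℝ, EuclideanSpace ℝ (Fin 4))
        (fun x => (f x : EuclideanSpace ℝ (Fin 4))) x
        = (mfderiv (𝓡 3) 𝓘(ℝ, EuclideanSpace ℝ (Fin 4))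
          ((↑) : C3 → EuclideanSpace ℝ (Fin 4)) (f x)).comp (mfderiv (𝓡 2) (𝓡 3) f x) :=
      mfderiv_comp x (hc.mdifferentiable (by simp) _) (hf.mdifferentiable (by simp) _)
    rw [h]
    exact (injective_mvfderiv_subtypeVal_sphere (f x)).comp (hinj x)
  obtain ⟨h1, h2⟩ := immersion_in_chart hF hFinj he
  have hL : ∀ u, lift (f (e.symm u)) = ![(f (e.symm u)).1 0, (f (e.symm u)).1 1,
      (f (e.symm u)).1 2, (f (e.symm u)).1 3, 1] := fun u => rfl
  have hsm : ContDiffOn ℝ ∞ (fun u => lift (f (e.symm u))) e.target := by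
    rw [contDiffOn_euclidean] at h1
    refine contDiffOn_pi.2 fun k => ?_
    fin_cases k
    exacts [h1 0, h1 1, h1 2, h1 3, contDiffOn_const]
  refine ⟨hsm, fun u hu v hv => h2 u hu v ?_⟩
  have hd : DifferentiableAt ℝ (fun u => lift (f (e.symm u))) u :=
    (hsm.differentiableOn (by simp)).differentiableAt (e.open_target.mem_nhds hu)
  have hd1 : DifferentiableAt ℝ (fun u => (f (e.symm u) : EuclideanSpace ℝ (Fin 4))) u :=
    (h1.differentiableOn (by simp)).differentiableAt (e.open_target.mem_nhds hu)
  have hk : ∀ k : Fin 4, fderiv ℝ (fun u => (f (e.symm u)).1 k) u v = 0 := by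
    intro k
    have h := (hasFDerivAt_pi'.1 hd.hasFDerivAt) k.castSucc
    have h' : (fun u => lift (f (e.symm u)) k.castSucc) = fun u => (f (e.symm u)).1 k := by
      funext u
      fin_cases k <;> rfl
    rw [h'] at h
    rw [h.fderiv, ContinuousLinearMap.comp_apply, hv, map_zero]
  ext k
  have h := ((EuclideanSpace.proj k : EuclideanSpace ℝ (Fin 4) →L[ℝ] ℝ).hasFDerivAt.comp u
    hd1.hasFDerivAt).fderiv
  have h' := hk k
  change fderiv ℝ (fun u => (f (e.symm u)).1 k) u = _ at h
  rw [h] at h'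
  exact h'

end Immersion

end

/-! ### Transfer to Euclidean space -/

section

/-- The correspondence between the coordinates of Euclidean spheres and polyspherical
coordinates. -/
def polyspherical : (ℝ × E3 × ℝ) ≃L[ℝ] Poly :=
  LinearEquiv.toContinuousLinearEquiv
    -- The coefficients are determined by requiring that the product with `nullVector y` be the left
    -- side of the equation of the sphere q.
    { toFun := fun q => ![-q.2.1 0, -q.2.1 1, -q.2.1 2, (q.1 - q.2.2) / 2, -(q.1 + q.2.2) / 2]
      map_add' := fun q r => by
        funext k
        fin_cases k <;> simp <;> ring
      map_smul' := fun c q => by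
        funext k
        fin_cases k <;> simp <;> ring
      invFun := fun S => (S 3 - S 4, !₂[-S 0, -S 1, -S 2], -(S 3 + S 4))
      left_inv := fun q => by
        refine Prod.ext ?_ (Prod.ext ?_ ?_)
        · simp; ring
        · ext k; fin_cases k <;> simp
        · simp; ring
      right_inv := fun S => by
        funext k
        fin_cases k <;> simp <;> ring }

lemma polyspherical_apply (q : ℝ × E3 × ℝ) : polyspherical q =
    ![-q.2.1 0, -q.2.1 1, -q.2.1 2, (q.1 - q.2.2) / 2, -(q.1 + q.2.2) / 2] := rfl

lemma norm_sq_eq (y : E3) : ‖y‖ ^ 2 = y 0 ^ 2 + y 1 ^ 2 + y 2 ^ 2 := by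
  simp [EuclideanSpace.norm_sq_eq, Fin.sum_univ_three]

lemma inner_eq (x y : E3) : ⟪x, y⟫ = x 0 * y 0 + x 1 * y 1 + x 2 * y 2 := by
  simp [PiLp.inner_apply, Fin.sum_univ_three, mul_comm]

lemma isSphere_polyspherical (q : ℝ × E3 × ℝ) : IsSphere (polyspherical q) ↔ IsSphereE q := by
  rw [IsSphere, IsSphereE, norm_sq_eq, ← sub_pos (b := q.1 * q.2.2), polyspherical_apply]
  have : form ![-q.2.1 0, -q.2.1 1, -q.2.1 2, (q.1 - q.2.2) / 2, -(q.1 + q.2.2) / 2]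
      ![-q.2.1 0, -q.2.1 1, -q.2.1 2, (q.1 - q.2.2) / 2, -(q.1 + q.2.2) / 2]
      = q.2.1 0 ^ 2 + q.2.1 1 ^ 2 + q.2.1 2 ^ 2 - q.1 * q.2.2 := by
    simp only [form, Matrix.cons_val]; ring
  rw [this]

/-- The null vector of a point of Euclidean space, with polynomial coordinates. -/
def nullVector (y : E3) : Poly := ![2 * y 0, 2 * y 1, 2 * y 2, ‖y‖ ^ 2 - 1, ‖y‖ ^ 2 + 1]

lemma nullVector_eq (y : E3) : nullVector y = (‖y‖ ^ 2 + 1) • lift (toConformal y) := by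
  have hp : ‖y‖ ^ 2 + 1 ≠ 0 := by positivity
  funext k
  fin_cases k <;> simp [nullVector, lift, toConformal] <;> field_simp

lemma lift_toConformal_eq (y : E3) : lift (toConformal y) = (‖y‖ ^ 2 + 1)⁻¹ • nullVector y := by
  have hp : ‖y‖ ^ 2 + 1 ≠ 0 := by positivity
  rw [nullVector_eq, smul_smul, inv_mul_cancel₀ hp, one_smul]

lemma form_polyspherical_nullVector (q : ℝ × E3 × ℝ) (y : E3) :
    form (polyspherical q) (nullVector y) = q.1 * ‖y‖ ^ 2 - 2 * ⟪q.2.1, y⟫ + q.2.2 := by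
  rw [polyspherical_apply, inner_eq]
  simp only [form, nullVector, Matrix.cons_val]
  ring

/-- The derivative of `nullVector` at `y` in the direction `z`. -/
def nullVectorDeriv (y z : E3) : Poly := ![2 * z 0, 2 * z 1, 2 * z 2, 2 * ⟪y, z⟫, 2 * ⟪y, z⟫]

lemma form_polyspherical_nullVectorDeriv (q : ℝ × E3 × ℝ) (y z : E3) :
    form (polyspherical q) (nullVectorDeriv y z) = 2 * ⟪q.1 • y - q.2.1, z⟫ := by
  rw [polyspherical_apply, inner_eq]
  simp only [form, nullVectorDeriv, Matrix.cons_val, inner_eq, PiLp.sub_apply, PiLp.smul_apply,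
    smul_eq_mul]
  ring

lemma contDiff_nullVector : ContDiff ℝ ∞ nullVector := by
  have h : ∀ k : Fin 3, ContDiff ℝ ∞ (fun y : E3 => y k) := fun k =>
    contDiff_euclidean.1 contDiff_id k
  have hn : ContDiff ℝ ∞ (fun y : E3 => ‖y‖ ^ 2) := contDiff_norm_sq ℝ
  refine contDiff_pi.2 fun k => ?_
  fin_cases k
  exacts [contDiff_const.mul (h 0), contDiff_const.mul (h 1), contDiff_const.mul (h 2),
    hn.sub contDiff_const, hn.add contDiff_const]

section Chart

variable {ψ : E2 → E3} {u : E2} (hψ : DifferentiableAt ℝ ψ u)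
include hψ

lemma fderiv_norm_sq_comp (v : E2) :
    fderiv ℝ (fun u => ‖ψ u‖ ^ 2) u v = 2 * ⟪ψ u, fderiv ℝ ψ u v⟫ := by
  have h : fderiv ℝ (fun u => ‖ψ u‖ ^ 2) u = _ := hψ.hasFDerivAt.norm_sq.fderiv
  rw [h]
  simp

lemma fderiv_nullVector_comp (v : E2) :
    fderiv ℝ (fun u => nullVector (ψ u)) u v = nullVectorDeriv (ψ u) (fderiv ℝ ψ u v) := by
  have hd : DifferentiableAt ℝ (fun u => nullVector (ψ u)) u :=
    ((contDiff_nullVector.differentiable (by simp)) _).comp u hψ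
  have hp : ∀ k : Fin 3, fderiv ℝ (fun u => 2 * ψ u k) u v = 2 * fderiv ℝ ψ u v k := fun k => by
    have h := (((EuclideanSpace.proj k : E3 →L[ℝ] ℝ).hasFDerivAt.comp u
      hψ.hasFDerivAt).const_mul 2).fderiv
    change fderiv ℝ (fun u => 2 * ψ u k) u = _ at h
    rw [h]
    rfl
  funext k
  have h := (hasFDerivAt_pi'.1 hd.hasFDerivAt k).fderiv
  have h' : fderiv ℝ (fun u => nullVector (ψ u)) u v k
      = fderiv ℝ (fun u => nullVector (ψ u) k) u v := by rw [h]; rfl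
  rw [h']
  fin_cases k
  · exact hp 0
  · exact hp 1
  · exact hp 2
  · change fderiv ℝ (fun u => ‖ψ u‖ ^ 2 - 1) u v = _
    rw [fderiv_sub_const, fderiv_norm_sq_comp hψ]; rfl
  · change fderiv ℝ (fun u => ‖ψ u‖ ^ 2 + 1) u v = _
    rw [fderiv_add_const, fderiv_norm_sq_comp hψ]; rfl

lemma differentiableAt_lift_comp : DifferentiableAt ℝ (fun u => lift (toConformal (ψ u))) u := by
  simp only [lift_toConformal_eq]
  exact ((hψ.norm_sq ℝ).add_const 1).inv (by positivity) |>.smul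
    (((contDiff_nullVector.differentiable (by simp)) _).comp u hψ)

/-- The product rule for `nullVector` as a rescaled `lift`. A sphere through the point annihilates
the last term, so contact does not depend on the normalization. -/
lemma nullVectorDeriv_eq (v : E2) : nullVectorDeriv (ψ u) (fderiv ℝ ψ u v)
    = (‖ψ u‖ ^ 2 + 1) • fderiv ℝ (fun u => lift (toConformal (ψ u))) u v
      + (2 * ⟪ψ u, fderiv ℝ ψ u v⟫) • lift (toConformal (ψ u)) := by
  rw [← fderiv_nullVector_comp hψ]
  simp only [nullVector_eq]
  have hk : DifferentiableAt ℝ (fun u => ‖ψ u‖ ^ 2 + 1) u := (hψ.norm_sq ℝ).add_const 1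
  have h : fderiv ℝ (fun u => (‖ψ u‖ ^ 2 + 1) • lift (toConformal (ψ u))) u = _ :=
    (hk.hasFDerivAt.smul (differentiableAt_lift_comp hψ).hasFDerivAt).fderiv
  rw [h]
  simp only [_root_.add_apply, _root_.smul_apply, ContinuousLinearMap.smulRight_apply,
    fderiv_add_const, fderiv_norm_sq_comp hψ]

end Chart

variable {M : Type*} [TopologicalSpace M] {φ : M → E3} {e : OpenPartialHomeomorph M E2}

lemma touches_toConformal_iff {u : E2} (hψ : DifferentiableAt ℝ (fun u => φ (e.symm u)) u)
    (q : ℝ × E3 × ℝ) :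
    Touches (toConformal ∘ φ) e (polyspherical q) u ↔ TouchesE φ e q u := by
  have hp : ‖φ (e.symm u)‖ ^ 2 + 1 ≠ 0 := by positivity
  have h0 : form (polyspherical q) (lift (toConformal (φ (e.symm u)))) = 0
      ↔ q.1 * ‖φ (e.symm u)‖ ^ 2 - 2 * ⟪q.2.1, φ (e.symm u)⟫ + q.2.2 = 0 := by
    rw [← form_polyspherical_nullVector, nullVector_eq, form_smul_right]
    simp [hp]
  unfold Touches TouchesE
  simp only [Function.comp_apply]
  rw [h0]
  refine and_congr_right fun h => forall_congr' fun v => ?_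
  have h1 := congrArg (form (polyspherical q)) (nullVectorDeriv_eq hψ v)
  rw [form_polyspherical_nullVectorDeriv, form_add_right, form_smul_right, form_smul_right,
    h0.2 h, mul_zero, add_zero] at h1
  constructor
  · intro h2
    rw [h2, mul_zero] at h1
    linarith
  · intro h2
    rw [h2, mul_zero] at h1
    exact (mul_eq_zero.1 h1.symm).resolve_left hp

lemma isEnvelope_toConformal_iff (hψ : ContDiffOn ℝ ∞ (fun u => φ (e.symm u)) e.target)
    {N : Set E2} (hN : IsOpen N) (hNe : N ⊆ e.target) {t : E2 → ℝ} :
    IsEnvelope IsSphereE (TouchesE φ e) N t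
      ↔ IsEnvelope IsSphere (Touches (toConformal ∘ φ) e) N t := by
  have hd : ∀ u ∈ N, DifferentiableAt ℝ (fun u => φ (e.symm u)) u := fun u hu =>
    (hψ.differentiableOn (by simp)).differentiableAt (e.open_target.mem_nhds (hNe hu))
  constructor
  · exact fun h => h.map hN polyspherical (fun q => (isSphere_polyspherical q).2)
      fun u hu q => (touches_toConformal_iff (hd u hu) q).2
  · refine fun h => h.map hN polyspherical.symm (fun S hS => ?_) fun u hu S hS => ?_
    · rw [← isSphere_polyspherical, ContinuousLinearEquiv.apply_symm_apply]; exact hS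
    · rw [← touches_toConformal_iff (hd u hu), ContinuousLinearEquiv.apply_symm_apply]; exact hS

lemma isImmersedAlong_toConformal (hψ : ContDiffOn ℝ ∞ (fun u => φ (e.symm u)) e.target)
    (hinj : ∀ u ∈ e.target, ∀ v, fderiv ℝ (fun u => φ (e.symm u)) u v = 0 → v = 0) :
    IsImmersedAlong (toConformal ∘ φ) e where
  smooth := by
    simp only [Function.comp_apply, lift_toConformal_eq]
    exact (((hψ.norm_sq ℝ).add contDiffOn_const).inv fun u _ => by positivity).smul
      (contDiff_nullVector.comp_contDiffOn hψ)
  injective := by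
    intro u hu v hv
    have hd : DifferentiableAt ℝ (fun u => φ (e.symm u)) u :=
      (hψ.differentiableOn (by simp)).differentiableAt (e.open_target.mem_nhds hu)
    have h := nullVectorDeriv_eq hd v
    simp only [Function.comp_apply] at hv
    rw [hv, smul_zero, zero_add] at h
    have hp : ‖φ (e.symm u)‖ ^ 2 + 1 ≠ 0 := by positivity
    -- Coordinate 3 reads 2⟪ψ, dψ⟫ = 2⟪ψ, dψ⟫ (‖ψ‖² - 1)/(‖ψ‖² + 1) with ψ the surface in the chart;
    -- the quotient is not 1, so the inner product is zero.
    have h3 := congrFun h 3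
    simp only [nullVectorDeriv, lift, toConformal, Matrix.cons_val, Pi.smul_apply, smul_eq_mul]
      at h3
    have hz : 2 * ⟪φ (e.symm u), fderiv ℝ (fun u => φ (e.symm u)) u v⟫ = 0 := by
      field_simp at h3
      linarith
    rw [hz, zero_smul] at h
    refine hinj u hu v ?_
    have h0 := congrFun h 0
    have h1 := congrFun h 1
    have h2 := congrFun h 2
    simp only [nullVectorDeriv, Matrix.cons_val, Pi.zero_apply, mul_eq_zero, OfNat.ofNat_ne_zero,
      false_or] at h0 h1 h2
    ext k
    fin_cases k
    exacts [h0, h1, h2]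

variable [ChartedSpace E2 M]

lemma isDupinCyclideE_iff (hψ : ∀ e ∈ IsManifold.maximalAtlas (𝓡 2) ∞ M,
    ContDiffOn ℝ ∞ (fun u => φ (e.symm u)) e.target) :
    IsDupinCyclideE φ ↔ IsDupinCyclide (toConformal ∘ φ) := by
  refine forall₂_congr fun e he => forall₂_congr fun u hu => exists_congr fun N => ?_
  refine and_congr_right fun hN => and_congr_right fun ho => and_congr_right fun _ => ?_
  refine exists_congr fun t₁ => exists_congr fun t₂ => ?_
  rw [isEnvelope_toConformal_iff (hψ e he) ho hN, isEnvelope_toConformal_iff (hψ e he) ho hN]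

lemma isCanalE_iff (hψ : ∀ e ∈ IsManifold.maximalAtlas (𝓡 2) ∞ M,
    ContDiffOn ℝ ∞ (fun u => φ (e.symm u)) e.target) :
    IsCanalE φ ↔ IsCanal (toConformal ∘ φ) := by
  refine forall₂_congr fun e he => forall₂_congr fun A hA => forall₂_congr fun u hu =>
    forall₂_congr fun v hv => exists_congr fun N => ?_
  refine and_congr_right fun hN => and_congr_right fun ho => and_congr_right fun _ => ?_
  refine exists_congr fun t => ?_
  rw [isEnvelope_toConformal_iff (hψ e he) ho hN]

end

end ConformalSurface

end

open ConformalSurface in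
theorem theorem3 {M : Type*} [TopologicalSpace M] [ChartedSpace E2 M] [IsManifold (𝓡 2) ∞ M]
    [ConnectedSpace M] :
    (∀ f : M → C3, ContMDiff (𝓡 2) (𝓡 3) ∞ f →
      (∀ x, Function.Injective (mfderiv (𝓡 2) (𝓡 3) f x)) → IsNondegenerate f →
        (IsDupinCyclide f ↔ ThirdTensorVanishes f) ∧ (IsDupinCyclide f ↔ IsCanal f)) ∧
    (∀ φ : M → E3, ContMDiff (𝓡 2) (𝓡 3) ∞ φ →
      (∀ x, Function.Injective (mfderiv (𝓡 2) (𝓡 3) φ x)) → IsNondegenerate (toConformal ∘ φ) →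
        (IsDupinCyclideE φ ↔ ThirdTensorVanishes (toConformal ∘ φ)) ∧
          (IsDupinCyclideE φ ↔ IsCanalE φ)) := by
  refine ⟨fun f hf hinj hnd => ?_, fun φ hφ hinj hnd => ?_⟩
  · exact isDupinCyclide_iff (fun e he => isImmersedAlong_of_contMDiff hf hinj he) hnd
  · have h := fun e (he : e ∈ IsManifold.maximalAtlas (𝓡 2) ∞ M) => immersion_in_chart hφ hinj he
    rw [isDupinCyclideE_iff fun e he => (h e he).1, isCanalE_iff fun e he => (h e he).1]
    exact isDupinCyclide_iff
      (fun e he => isImmersedAlong_toConformal (h e he).1 (h e he).2) hnd
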